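/- For $s,h>0$ let $\mathcal S_{s,h}(\mathbf R^d)$ be the space of all $f\in C^\infty(\mathbf R^d)$ (complex valued) such that $$\|f\|_{\mathcal S_{s,h}}=\sup_{\alpha,\beta\in\mathbf N^d,\ x\in\mathbf R^d}\frac{|x^\beta\partial^\alpha f(x)|}{h^{|\alpha|+|\beta|}(\alpha!\,\beta!)^s}<\infty .$$ Let $\mathcal S_s(\mathbf R^d)=\bigcup_{h>0}\mathcal S_{s,h}(\mathbf R^d)$ with the inductive limit topology (the strongest topology such that every inclusion $\mathcal S_{s,h}\subseteq\mathcal S_s$ is continuous), let $\Sigma_s(\mathbf R^d)=\bigcap_{h>0}\mathcal S_{s,h}(\mathbf R^d)$ with the projective limit topology given by the norms $\|\cdot\|_{\mathcal S_{s,h}}$, $h>0$, and let $\mathcal S_s'(\mathbf R^d)$ and $\Sigma_s'(\mathbf R^d)$ be their topological duals, with the action of $f$ on $\phi$ written $\langle f,\phi\rangle$ (linear in $\phi$). **Theorem.** Let $s\ge 1/2$ and $f_j\in\mathcal S_s'(\mathbf R^{d_j})$, $j=1,2$. There exists a unique $f=f_1\otimes f_2\in\mathcal S_s'(\mathbf R^{d_1+d_2})$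 such that $$\langle f_1\otimes f_2,\phi_1\otimes\phi_2\rangle=\langle f_1,\phi_1\rangle\langle f_2,\phi_2\rangle,\qquad \phi_j\in\mathcal S_s(\mathbf R^{d_j}),\ j=1,2,$$ where $(\phi_1\otimes\phi_2)(x_1,x_2)=\phi_1(x_1)\phi_2(x_2)$. Moreover, for every $\phi\in\mathcal S_s(\mathbf R^{d_1+d_2})$ the function $x_1\mapsto\langle f_2,\phi(x_1,\cdot)\rangle$ belongs to $\mathcal S_s(\mathbf R^{d_1})$, the function $x_2\mapsto\langle f_1,\phi(\cdot,x_2)\rangle$ belongs to $\mathcal S_s(\mathbf R^{d_2})$, and $$\langle f,\phi\rangle=\langle f_1,\langle f_2,\phi(x_1,x_2)\rangle\rangle=\langle f_2,\langle f_1,\phi(x_1,x_2)\rangle\rangle ,$$ where $f_j$ acts on the variable $x_j$ only, $j=1,2$. The same conclusions hold for $s>1/2$ and $f_j\in\Sigma_s'(\mathbf R^{d_j})$, $j=1,2$, with $\mathcal S_s$ and $\mathcal S_s'$ replaced by $\Sigma_s$ and $\Sigma_s'$ throughout. -/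

import Mathlib

open scoped ContDiff

noncomputable section

namespace GelfandShilov

/-- Partial derivative `∂ᵢ f` of a function on `ℝᵈ`. (Smoothness and partial derivatives do not
depend on which norm `ℝᵈ` carries.) -/
def partialD {d : ℕ} (i : Fin d) (f : (Fin d → ℝ) → ℂ) : (Fin d → ℝ) → ℂ :=
  fun x => fderiv ℝ f x (Pi.single i 1)

/-- `∂^α f = ∂₁^{α₁} ⋯ ∂_d^{α_d} f` for a multi-index `α`. -/
def multiD {d : ℕ} (α : Fin d → ℕ) (f : (Fin d → ℝ) → ℂ) : (Fin d → ℝ) → ℂ :=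
  (List.finRange d).foldr (fun i g => (partialD i)^[α i] g) f

/-- The monomial `x^β`. -/
def monomial {d : ℕ} (β : Fin d → ℕ) (x : Fin d → ℝ) : ℝ := ∏ i, x i ^ β i

/-- `h^{|α|+|β|} (α! β!)^s`. -/
def weight {d : ℕ} (s h : ℝ) (α β : Fin d → ℕ) : ℝ :=
  h ^ ((∑ i, α i) + ∑ i, β i) *
    (((∏ i, (α i).factorial) * ∏ i, (β i).factorial : ℕ) : ℝ) ^ s

/-- `|x^β ∂^α f(x)| / (h^{|α|+|β|} (α! β!)^s)`, with `p = (α, β, x)`. -/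
def quot {d : ℕ} (s h : ℝ) (f : (Fin d → ℝ) → ℂ)
    (p : (Fin d → ℕ) × (Fin d → ℕ) × (Fin d → ℝ)) : ℝ :=
  ‖(monomial p.2.1 p.2.2 : ℂ) * multiD p.1 f p.2.2‖ / weight s h p.1 p.2.1

section Aux

variable {d d' : ℕ}

theorem weight_pos (s : ℝ) {h : ℝ} (hh : 0 < h) (α β : Fin d → ℕ) : 0 < weight s h α β := by
  have h1 : 0 < (∏ i, (α i).factorial) * ∏ i, (β i).factorial :=
    Nat.mul_pos (Finset.prod_pos fun i _ => Nat.factorial_pos _)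
      (Finset.prod_pos fun i _ => Nat.factorial_pos _)
  exact mul_pos (pow_pos hh _) (Real.rpow_pos_of_pos (by exact_mod_cast h1) _)

theorem weight_mono (s : ℝ) {h k : ℝ} (hh : 0 < h) (hk : h ≤ k) (α β : Fin d → ℕ) :
    weight s h α β ≤ weight s k α β := by
  unfold weight
  gcongr

theorem quot_nonneg (s : ℝ) {h : ℝ} (hh : 0 < h) (f : (Fin d → ℝ) → ℂ) (p) :
    0 ≤ quot s h f p :=
  div_nonneg (norm_nonneg _) (weight_pos s hh _ _).le

theorem quot_anti (s : ℝ) {h k : ℝ} (hh : 0 < h) (hk : h ≤ k) (f : (Fin d → ℝ) → ℂ) (p) :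
    quot s k f p ≤ quot s h f p :=
  div_le_div_of_nonneg_left (norm_nonneg _) (weight_pos s hh _ _) (weight_mono s hh hk _ _)

theorem contDiff_partialD {f : (Fin d → ℝ) → ℂ} (hf : ContDiff ℝ ∞ f) (i : Fin d) :
    ContDiff ℝ ∞ (partialD i f) :=
  (hf.fderiv_right (m := ∞) (by simp)).clm_apply contDiff_const

theorem contDiff_iter {f : (Fin d → ℝ) → ℂ} (hf : ContDiff ℝ ∞ f) (i : Fin d) (n : ℕ) :
    ContDiff ℝ ∞ ((partialD i)^[n] f) := by
  induction n with
  | zero => exact hf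
  | succ n ih => rw [Function.iterate_succ_apply']; exact contDiff_partialD ih i

theorem contDiff_foldr {ι : Type} (e : ι → Fin d) (m : ι → ℕ) (l : List ι)
    {f : (Fin d → ℝ) → ℂ} (hf : ContDiff ℝ ∞ f) :
    ContDiff ℝ ∞ (l.foldr (fun i g => (partialD (e i))^[m i] g) f) := by
  induction l with
  | nil => exact hf
  | cons a l ih => exact contDiff_iter ih _ _

theorem iter_comm (T : ((Fin d → ℝ) → ℂ) → ((Fin d' → ℝ) → ℂ)) (i : Fin d) (j : Fin d')
    (h : ∀ g, ContDiff ℝ ∞ g → partialD j (T g) = T (partialD i g)) (n : ℕ)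
    {g : (Fin d → ℝ) → ℂ} (hg : ContDiff ℝ ∞ g) :
    (partialD j)^[n] (T g) = T ((partialD i)^[n] g) := by
  induction n with
  | zero => rfl
  | succ n ih =>
    rw [Function.iterate_succ_apply', Function.iterate_succ_apply', ih, h _ (contDiff_iter hg _ _)]

theorem foldr_comm {ι : Type} (T : ((Fin d → ℝ) → ℂ) → ((Fin d' → ℝ) → ℂ))
    (e : ι → Fin d) (e' : ι → Fin d') (m : ι → ℕ)
    (h : ∀ i g, ContDiff ℝ ∞ g → partialD (e' i) (T g) = T (partialD (e i) g)) (l : List ι)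
    {g : (Fin d → ℝ) → ℂ} (hg : ContDiff ℝ ∞ g) :
    l.foldr (fun i g => (partialD (e' i))^[m i] g) (T g) =
      T (l.foldr (fun i g => (partialD (e i))^[m i] g) g) := by
  induction l with
  | nil => rfl
  | cons a l ih =>
    simp only [List.foldr_cons]
    rw [ih, iter_comm T (e a) (e' a) (h a) _ (contDiff_foldr _ _ _ hg)]

theorem partialD_add {f g : (Fin d → ℝ) → ℂ} (hf : ContDiff ℝ ∞ f) (hg : ContDiff ℝ ∞ g)
    (i : Fin d) : partialD i (f + g) = partialD i f + partialD i g := by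
  funext x
  simp [partialD, fderiv_add (hf.differentiable (by simp) x) (hg.differentiable (by simp) x)]

theorem partialD_smul (c : ℂ) {f : (Fin d → ℝ) → ℂ} (hf : ContDiff ℝ ∞ f)
    (i : Fin d) : partialD i (c • f) = c • partialD i f := by
  funext x
  simp [partialD, fderiv_const_smul (hf.differentiable (by simp) x)]

theorem multiD_add (α : Fin d → ℕ) {f g : (Fin d → ℝ) → ℂ} (hf : ContDiff ℝ ∞ f)
    (hg : ContDiff ℝ ∞ g) : multiD α (f + g) = multiD α f + multiD α g := by
  have hit : ∀ (i : Fin d) (n : ℕ) {f g : (Fin d → ℝ) → ℂ}, ContDiff ℝ ∞ f → ContDiff ℝ ∞ g →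
      (partialD i)^[n] (f + g) = (partialD i)^[n] f + (partialD i)^[n] g := by
    intro i n f g hf hg
    induction n with
    | zero => rfl
    | succ n ih =>
      simp only [Function.iterate_succ_apply']
      rw [ih, partialD_add (contDiff_iter hf _ _) (contDiff_iter hg _ _)]
  unfold multiD
  induction List.finRange d with
  | nil => rfl
  | cons a l ih =>
    simp only [List.foldr_cons]
    rw [ih]
    exact hit a _ (contDiff_foldr _root_.id α l hf) (contDiff_foldr _root_.id α l hg)

theorem multiD_smul (α : Fin d → ℕ) (c : ℂ) {f : (Fin d → ℝ) → ℂ} (hf : ContDiff ℝ ∞ f) :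
    multiD α (c • f) = c • multiD α f :=
  foldr_comm (fun g => c • g) _root_.id _root_.id α (fun i _ hg => partialD_smul c hg i) _ hf

theorem quot_add (s : ℝ) {h : ℝ} (hh : 0 < h) {f g : (Fin d → ℝ) → ℂ} (hf : ContDiff ℝ ∞ f)
    (hg : ContDiff ℝ ∞ g) (p) : quot s h (f + g) p ≤ quot s h f p + quot s h g p := by
  unfold quot
  rw [multiD_add _ hf hg, ← add_div, Pi.add_apply, mul_add]
  have := weight_pos s hh p.1 p.2.1
  gcongr
  exact norm_add_le _ _

theorem quot_smul (s h : ℝ) (c : ℂ) {f : (Fin d → ℝ) → ℂ} (hf : ContDiff ℝ ∞ f) (p) :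
    quot s h (c • f) p = ‖c‖ * quot s h f p := by
  unfold quot
  rw [multiD_smul _ _ hf, Pi.smul_apply, smul_eq_mul, mul_left_comm, norm_mul c, mul_div_assoc]

theorem contDiff_zero_fun : ContDiff ℝ ∞ (0 : (Fin d → ℝ) → ℂ) := contDiff_const

theorem quot_zero (s h : ℝ) (p) : quot s h (0 : (Fin d → ℝ) → ℂ) p = 0 := by
  have := quot_smul s h 0 (contDiff_zero_fun (d := d)) p
  simpa using this

end Aux

/-- The functions in `𝒮_{s,h}(ℝᵈ)`, `h > 0`: the smooth functions with
`sup_{α,β,x} |x^β ∂^α f(x)| / (h^{|α|+|β|} (α! β!)^s) < ∞`. -/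
def stepSub (d : ℕ) (s : ℝ) (h : {h : ℝ // 0 < h}) : Submodule ℂ ((Fin d → ℝ) → ℂ) where
  carrier := {f | ContDiff ℝ ∞ f ∧ BddAbove (Set.range (quot s h f))}
  zero_mem' := ⟨contDiff_zero_fun, 0, by rintro _ ⟨p, rfl⟩; exact (quot_zero s h p).le⟩
  add_mem' := by
    rintro f g ⟨hf, A, hA⟩ ⟨hg, B, hB⟩
    refine ⟨hf.add hg, A + B, ?_⟩
    rintro _ ⟨p, rfl⟩
    exact (quot_add s h.2 hf hg p).trans (add_le_add (hA ⟨p, rfl⟩) (hB ⟨p, rfl⟩))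
  smul_mem' := by
    rintro c f ⟨hf, A, hA⟩
    refine ⟨contDiff_const.smul hf, ‖c‖ * A, ?_⟩
    rintro _ ⟨p, rfl⟩
    rw [quot_smul s h c hf]
    exact mul_le_mul_of_nonneg_left (hA ⟨p, rfl⟩) (norm_nonneg _)

theorem stepSub_mono (d : ℕ) (s : ℝ) {h k : {h : ℝ // 0 < h}} (hk : h ≤ k) :
    stepSub d s h ≤ stepSub d s k := by
  rintro f ⟨hf, A, hA⟩
  refine ⟨hf, A, ?_⟩
  rintro _ ⟨p, rfl⟩
  exact (quot_anti s h.2 hk f p).trans (hA ⟨p, rfl⟩)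

/-- The space `𝒮_{s,h}(ℝᵈ)`, as a type of its own so that its topology is that of its norm. -/
def Step (d : ℕ) (s : ℝ) (h : {h : ℝ // 0 < h}) : Type := ↥(stepSub d s h)

instance (d : ℕ) (s : ℝ) (h : {h : ℝ // 0 < h}) : AddCommGroup (Step d s h) :=
  inferInstanceAs (AddCommGroup ↥(stepSub d s h))
instance (d : ℕ) (s : ℝ) (h : {h : ℝ // 0 < h}) : Module ℂ (Step d s h) :=
  inferInstanceAs (Module ℂ ↥(stepSub d s h))

/-- The norm `‖f‖_{𝒮_{s,h}} = sup_{α,β,x} |x^β ∂^α f(x)| / (h^{|α|+|β|} (α! β!)^s)`. -/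
instance (d : ℕ) (s : ℝ) (h : {h : ℝ // 0 < h}) : NormedAddCommGroup (Step d s h) :=
  AddGroupNorm.toNormedAddCommGroup
    { toFun := fun f => ⨆ p, quot s h f.1 p
      map_zero' := by
        change (⨆ p, quot s h (0 : (Fin d → ℝ) → ℂ) p) = 0
        simp [quot_zero]
      add_le' := fun f g => ciSup_le fun p =>
        (quot_add s h.2 f.2.1 g.2.1 p).trans (add_le_add (le_ciSup f.2.2 p) (le_ciSup g.2.2 p))
      neg' := fun f => by
        have hneg : (-f).1 = (-1 : ℂ) • f.1 := by
          rw [neg_one_smul]; rfl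
        simp_rw [hneg, quot_smul s h (-1) f.2.1]
        simp
      eq_zero_of_map_eq_zero' := fun f hf => by
        refine Subtype.ext (funext fun x => ?_)
        have h1 : quot s h f.1 (0, 0, x) ≤ 0 := by
          have h2 := le_ciSup f.2.2 (0, 0, x)
          exact h2.trans (le_of_eq hf)
        have h3 : multiD 0 f.1 = f.1 := by
          unfold multiD
          induction List.finRange d with
          | nil => rfl
          | cons a l ih => simp
        have h4 : quot s h f.1 (0, 0, x) = ‖f.1 x‖ := by
          simp [quot, weight, monomial, h3]
        rw [h4] at h1
        exact norm_le_zero_iff.1 h1 }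

theorem Step.norm_def {d : ℕ} {s : ℝ} {h : {h : ℝ // 0 < h}} (f : Step d s h) :
    ‖f‖ = ⨆ p, quot s h f.1 p := rfl

instance (d : ℕ) (s : ℝ) (h : {h : ℝ // 0 < h}) : NormedSpace ℂ (Step d s h) where
  norm_smul_le c f := by
    rw [Step.norm_def, Step.norm_def, Real.mul_iSup_of_nonneg (norm_nonneg _)]
    exact le_of_eq (congrArg iSup (funext fun p => quot_smul s h c f.2.1 p))

/-- The functions in `𝒮_s(ℝᵈ) = ⋃_{h>0} 𝒮_{s,h}(ℝᵈ)`. -/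
def gsSub (d : ℕ) (s : ℝ) : Submodule ℂ ((Fin d → ℝ) → ℂ) where
  carrier := {f | ∃ h, f ∈ stepSub d s h}
  zero_mem' := ⟨⟨1, one_pos⟩, Submodule.zero_mem _⟩
  add_mem' := by
    rintro f g ⟨h, hf⟩ ⟨k, hg⟩
    exact ⟨max h k, Submodule.add_mem _ (stepSub_mono d s (le_max_left h k) hf)
      (stepSub_mono d s (le_max_right h k) hg)⟩
  smul_mem' := by
    rintro c f ⟨h, hf⟩
    exact ⟨h, Submodule.smul_mem _ c hf⟩

/-- The functions in `Σ_s(ℝᵈ) = ⋂_{h>0} 𝒮_{s,h}(ℝᵈ)`. -/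
def sigSub (d : ℕ) (s : ℝ) : Submodule ℂ ((Fin d → ℝ) → ℂ) := ⨅ h, stepSub d s h

/-- The Gelfand-Shilov space `𝒮_s(ℝᵈ)`. -/
def GS (d : ℕ) (s : ℝ) : Type := ↥(gsSub d s)

/-- The Gelfand-Shilov space `Σ_s(ℝᵈ)`. -/
def Sig (d : ℕ) (s : ℝ) : Type := ↥(sigSub d s)

instance (d : ℕ) (s : ℝ) : AddCommGroup (GS d s) := inferInstanceAs (AddCommGroup ↥(gsSub d s))
instance (d : ℕ) (s : ℝ) : Module ℂ (GS d s) := inferInstanceAs (Module ℂ ↥(gsSub d s))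
instance (d : ℕ) (s : ℝ) : AddCommGroup (Sig d s) := inferInstanceAs (AddCommGroup ↥(sigSub d s))
instance (d : ℕ) (s : ℝ) : Module ℂ (Sig d s) := inferInstanceAs (Module ℂ ↥(sigSub d s))

instance (d : ℕ) (s : ℝ) : CoeFun (GS d s) (fun _ => (Fin d → ℝ) → ℂ) := ⟨fun f => f.1⟩
instance (d : ℕ) (s : ℝ) : CoeFun (Sig d s) (fun _ => (Fin d → ℝ) → ℂ) := ⟨fun f => f.1⟩

/-- The inclusion `𝒮_{s,h}(ℝᵈ) ⊆ 𝒮_s(ℝᵈ)`. -/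
def stepToGS (d : ℕ) (s : ℝ) (h : {h : ℝ // 0 < h}) : Step d s h →ₗ[ℂ] GS d s where
  toFun f := ⟨f.1, h, f.2⟩
  map_add' _ _ := rfl
  map_smul' _ _ := rfl

/-- The inclusion `Σ_s(ℝᵈ) ⊆ 𝒮_{s,h}(ℝᵈ)`. -/
def sigToStep (d : ℕ) (s : ℝ) (h : {h : ℝ // 0 < h}) : Sig d s →ₗ[ℂ] Step d s h where
  toFun f := ⟨f.1, (Submodule.mem_iInf _).1 f.2 h⟩
  map_add' _ _ := rfl
  map_smul' _ _ := rfl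

/-- The inductive limit topology on `𝒮_s(ℝᵈ)`: the strongest topology for which every inclusion
`𝒮_{s,h}(ℝᵈ) ⊆ 𝒮_s(ℝᵈ)` is continuous. -/
instance (d : ℕ) (s : ℝ) : TopologicalSpace (GS d s) :=
  ⨆ h, TopologicalSpace.coinduced (stepToGS d s h) inferInstance

/-- The projective limit topology on `Σ_s(ℝᵈ)`, given by the norms of all the `𝒮_{s,h}(ℝᵈ)`. -/
instance (d : ℕ) (s : ℝ) : TopologicalSpace (Sig d s) :=
  ⨅ h, TopologicalSpace.induced (sigToStep d s h) inferInstance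

/-- The distribution space `𝒮_s'(ℝᵈ)`, the topological dual of `𝒮_s(ℝᵈ)`; the action
`⟨f, φ⟩ = f φ` is linear in `φ`. -/
abbrev GSDual (d : ℕ) (s : ℝ) : Type := GS d s →L[ℂ] ℂ

/-- The distribution space `Σ_s'(ℝᵈ)`, the topological dual of `Σ_s(ℝᵈ)`. -/
abbrev SigDual (d : ℕ) (s : ℝ) : Type := Sig d s →L[ℂ] ℂ

/-- `(φ₁ ⊗ φ₂)(x₁, x₂) = φ₁(x₁) φ₂(x₂)` on `ℝ^{d₁+d₂}`. -/
def tensorFun {d₁ d₂ : ℕ} (φ₁ : (Fin d₁ → ℝ) → ℂ) (φ₂ : (Fin d₂ → ℝ) → ℂ) :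
    (Fin (d₁ + d₂) → ℝ) → ℂ :=
  fun x => φ₁ (fun i => x (Fin.castAdd d₂ i)) * φ₂ (fun j => x (Fin.natAdd d₁ j))

/-- `φ(x₁, ·)`. -/
def fixFst {d₁ d₂ : ℕ} (x₁ : Fin d₁ → ℝ) (φ : (Fin (d₁ + d₂) → ℝ) → ℂ) : (Fin d₂ → ℝ) → ℂ :=
  fun x₂ => φ (Fin.append x₁ x₂)

/-- `φ(·, x₂)`. -/
def fixSnd {d₁ d₂ : ℕ} (x₂ : Fin d₂ → ℝ) (φ : (Fin (d₁ + d₂) → ℝ) → ℂ) : (Fin d₁ → ℝ) → ℂ :=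
  fun x₁ => φ (Fin.append x₁ x₂)

section Aux

variable {d₁ d₂ : ℕ}

theorem finRange_add : List.finRange (d₁ + d₂) =
    (List.finRange d₁).map (Fin.castAdd d₂) ++ (List.finRange d₂).map (Fin.natAdd d₁) := by
  apply List.ext_getElem
  · simp
  · intro n h1 h2
    rw [List.getElem_append]
    split_ifs with h
    · ext; simp
    · ext; simp at h ⊢; omega

theorem hasFDerivAt_append_right (x₁ : Fin d₁ → ℝ) (x₂ : Fin d₂ → ℝ) :
    ∃ L : (Fin d₂ → ℝ) →L[ℝ] (Fin (d₁ + d₂) → ℝ),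
      HasFDerivAt (fun y : Fin d₂ → ℝ => (Fin.append x₁ y : Fin (d₁ + d₂) → ℝ)) L x₂ ∧
      ∀ j, L (Pi.single j 1) = Pi.single (Fin.natAdd d₁ j) 1 := by
  refine ⟨ContinuousLinearMap.pi (Fin.addCases (fun _ => 0)
    (fun j => ContinuousLinearMap.proj j)), ?_, ?_⟩
  · rw [hasFDerivAt_pi]
    intro k
    refine Fin.addCases (fun i => ?_) (fun j => ?_) k
    · simpa using hasFDerivAt_const (x₁ i) x₂
    · simpa using hasFDerivAt_apply (𝕜 := ℝ) j x₂
  · intro j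
    ext k
    refine Fin.addCases (fun i => ?_) (fun l => ?_) k
    · have : Fin.castAdd d₂ i ≠ Fin.natAdd d₁ j := by
        intro h; have := congrArg Fin.val h; simp at this; omega
      simp [this]
    · simp [Pi.single_apply]

theorem hasFDerivAt_append_left (x₁ : Fin d₁ → ℝ) (x₂ : Fin d₂ → ℝ) :
    ∃ L : (Fin d₁ → ℝ) →L[ℝ] (Fin (d₁ + d₂) → ℝ),
      HasFDerivAt (fun y : Fin d₁ → ℝ => (Fin.append y x₂ : Fin (d₁ + d₂) → ℝ)) L x₁ ∧
      ∀ j, L (Pi.single j 1) = Pi.single (Fin.castAdd d₂ j) 1 := by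
  refine ⟨ContinuousLinearMap.pi (Fin.addCases
    (fun j => ContinuousLinearMap.proj j) (fun _ => 0)), ?_, ?_⟩
  · rw [hasFDerivAt_pi]
    intro k
    refine Fin.addCases (fun i => ?_) (fun j => ?_) k
    · simpa using hasFDerivAt_apply (𝕜 := ℝ) i x₁
    · simpa using hasFDerivAt_const (x₂ j) x₁
  · intro j
    ext k
    refine Fin.addCases (fun i => ?_) (fun l => ?_) k
    · simp [Pi.single_apply]
    · have : Fin.natAdd d₁ l ≠ Fin.castAdd d₂ j := by
        intro h; have := congrArg Fin.val h; simp at this; omega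
      simp [this]

theorem contDiff_fixFst (x₁ : Fin d₁ → ℝ) {φ : (Fin (d₁ + d₂) → ℝ) → ℂ} (hφ : ContDiff ℝ ∞ φ) :
    ContDiff ℝ ∞ (fixFst x₁ φ) := by
  refine hφ.comp (contDiff_pi.2 fun k => ?_)
  refine Fin.addCases (fun i => ?_) (fun j => ?_) k
  · simpa using contDiff_const
  · simpa using contDiff_apply ℝ ℝ j

theorem contDiff_fixSnd (x₂ : Fin d₂ → ℝ) {φ : (Fin (d₁ + d₂) → ℝ) → ℂ} (hφ : ContDiff ℝ ∞ φ) :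
    ContDiff ℝ ∞ (fixSnd x₂ φ) := by
  refine hφ.comp (contDiff_pi.2 fun k => ?_)
  refine Fin.addCases (fun i => ?_) (fun j => ?_) k
  · simpa using contDiff_apply ℝ ℝ i
  · simpa using contDiff_const

theorem partialD_fixFst (x₁ : Fin d₁ → ℝ) {φ : (Fin (d₁ + d₂) → ℝ) → ℂ} (hφ : ContDiff ℝ ∞ φ)
    (j : Fin d₂) : partialD j (fixFst x₁ φ) = fixFst x₁ (partialD (Fin.natAdd d₁ j) φ) := by
  funext x₂
  obtain ⟨L, hL, hL'⟩ := hasFDerivAt_append_right x₁ x₂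
  have h := ((hφ.differentiable (by simp) (Fin.append x₁ x₂)).hasFDerivAt.comp x₂ hL).fderiv
  simp only [Function.comp_def] at h
  change fderiv ℝ (fixFst _ φ) _ _ = fderiv ℝ φ _ _
  unfold fixFst
  rw [h, ContinuousLinearMap.comp_apply, hL']

theorem partialD_fixSnd (x₂ : Fin d₂ → ℝ) {φ : (Fin (d₁ + d₂) → ℝ) → ℂ} (hφ : ContDiff ℝ ∞ φ)
    (j : Fin d₁) : partialD j (fixSnd x₂ φ) = fixSnd x₂ (partialD (Fin.castAdd d₂ j) φ) := by
  funext x₁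
  obtain ⟨L, hL, hL'⟩ := hasFDerivAt_append_left x₁ x₂
  have h := ((hφ.differentiable (by simp) (Fin.append x₁ x₂)).hasFDerivAt.comp x₁ hL).fderiv
  simp only [Function.comp_def] at h
  change fderiv ℝ (fixSnd _ φ) _ _ = fderiv ℝ φ _ _
  unfold fixSnd
  rw [h, ContinuousLinearMap.comp_apply, hL']

theorem multiD_append (α₁ : Fin d₁ → ℕ) (α₂ : Fin d₂ → ℕ) (φ : (Fin (d₁ + d₂) → ℝ) → ℂ) :
    multiD (Fin.append α₁ α₂) φ =
      (List.finRange d₁).foldr (fun i g => (partialD (Fin.castAdd d₂ i))^[α₁ i] g)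
        ((List.finRange d₂).foldr (fun j g => (partialD (Fin.natAdd d₁ j))^[α₂ j] g) φ) := by
  simp only [multiD, finRange_add, List.foldr_append, List.foldr_map, Fin.append_left,
    Fin.append_right]

theorem foldr_zero {d : ℕ} {ι : Type} (e : ι → Fin d) (l : List ι) (φ : (Fin d → ℝ) → ℂ) :
    l.foldr (fun i g => (partialD (e i))^[(0 : ι → ℕ) i] g) φ = φ := by
  induction l with
  | nil => rfl
  | cons a l ih => simp

theorem multiD_fixFst (x₁ : Fin d₁ → ℝ) {φ : (Fin (d₁ + d₂) → ℝ) → ℂ} (hφ : ContDiff ℝ ∞ φ)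
    (α : Fin d₂ → ℕ) : multiD α (fixFst x₁ φ) = fixFst x₁ (multiD (Fin.append 0 α) φ) := by
  rw [multiD_append, foldr_zero]
  exact foldr_comm (fixFst x₁) (Fin.natAdd d₁) _root_.id α
    (fun j _ hg => partialD_fixFst x₁ hg j) _ hφ

theorem multiD_fixSnd (x₂ : Fin d₂ → ℝ) {φ : (Fin (d₁ + d₂) → ℝ) → ℂ} (hφ : ContDiff ℝ ∞ φ)
    (α : Fin d₁ → ℕ) : multiD α (fixSnd x₂ φ) = fixSnd x₂ (multiD (Fin.append α 0) φ) := by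
  rw [multiD_append, foldr_zero]
  exact foldr_comm (fixSnd x₂) (Fin.castAdd d₂) _root_.id α
    (fun j _ hg => partialD_fixSnd x₂ hg j) _ hφ

theorem quot_fixFst (s h : ℝ) (x₁ : Fin d₁ → ℝ) {φ : (Fin (d₁ + d₂) → ℝ) → ℂ}
    (hφ : ContDiff ℝ ∞ φ) (p) : quot s h (fixFst x₁ φ) p =
      quot s h φ (Fin.append 0 p.1, Fin.append 0 p.2.1, Fin.append x₁ p.2.2) := by
  unfold quot
  rw [multiD_fixFst x₁ hφ]
  simp [fixFst, monomial, weight, Fin.sum_univ_add, Fin.prod_univ_add]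

theorem quot_fixSnd (s h : ℝ) (x₂ : Fin d₂ → ℝ) {φ : (Fin (d₁ + d₂) → ℝ) → ℂ}
    (hφ : ContDiff ℝ ∞ φ) (p) : quot s h (fixSnd x₂ φ) p =
      quot s h φ (Fin.append p.1 0, Fin.append p.2.1 0, Fin.append p.2.2 x₂) := by
  unfold quot
  rw [multiD_fixSnd x₂ hφ]
  simp [fixSnd, monomial, weight, Fin.sum_univ_add, Fin.prod_univ_add]

theorem fixFst_mem {s : ℝ} {h} (x₁ : Fin d₁ → ℝ) {φ : (Fin (d₁ + d₂) → ℝ) → ℂ}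
    (hφ : φ ∈ stepSub (d₁ + d₂) s h) : fixFst x₁ φ ∈ stepSub d₂ s h := by
  obtain ⟨h1, A, hA⟩ := hφ
  refine ⟨contDiff_fixFst x₁ h1, A, ?_⟩
  rintro _ ⟨p, rfl⟩
  rw [quot_fixFst s h x₁ h1]
  exact hA ⟨_, rfl⟩

theorem fixSnd_mem {s : ℝ} {h} (x₂ : Fin d₂ → ℝ) {φ : (Fin (d₁ + d₂) → ℝ) → ℂ}
    (hφ : φ ∈ stepSub (d₁ + d₂) s h) : fixSnd x₂ φ ∈ stepSub d₁ s h := by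
  obtain ⟨h1, A, hA⟩ := hφ
  refine ⟨contDiff_fixSnd x₂ h1, A, ?_⟩
  rintro _ ⟨p, rfl⟩
  rw [quot_fixSnd s h x₂ h1]
  exact hA ⟨_, rfl⟩

/-- Restriction of the coordinates is a continuous linear map. -/
def reidx {d d' : ℕ} (e : Fin d → Fin d') : (Fin d' → ℝ) →L[ℝ] (Fin d → ℝ) :=
  ContinuousLinearMap.pi fun i => ContinuousLinearMap.proj (e i)

theorem hasFDerivAt_tensorFun {φ₁ : (Fin d₁ → ℝ) → ℂ} {φ₂ : (Fin d₂ → ℝ) → ℂ}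
    (h1 : ContDiff ℝ ∞ φ₁) (h2 : ContDiff ℝ ∞ φ₂) (x v : Fin (d₁ + d₂) → ℝ) :
    fderiv ℝ (tensorFun φ₁ φ₂) x v =
      φ₁ (reidx (Fin.castAdd d₂) x) *
          fderiv ℝ φ₂ (reidx (Fin.natAdd d₁) x) (reidx (Fin.natAdd d₁) v) +
        fderiv ℝ φ₁ (reidx (Fin.castAdd d₂) x) (reidx (Fin.castAdd d₂) v) *
          φ₂ (reidx (Fin.natAdd d₁) x) := by
  have a1 := (h1.differentiable (by simp) (reidx (Fin.castAdd d₂) x)).hasFDerivAt.comp x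
    (reidx (Fin.castAdd d₂)).hasFDerivAt
  have a2 := (h2.differentiable (by simp) (reidx (Fin.natAdd d₁) x)).hasFDerivAt.comp x
    (reidx (Fin.natAdd d₁)).hasFDerivAt
  have a3 := (a1.mul a2).fderiv
  have a4 : tensorFun φ₁ φ₂ = (φ₁ ∘ reidx (Fin.castAdd d₂)) * (φ₂ ∘ reidx (Fin.natAdd d₁)) := rfl
  rw [a4, a3]
  simp [mul_comm]

theorem contDiff_tensorFun {φ₁ : (Fin d₁ → ℝ) → ℂ} {φ₂ : (Fin d₂ → ℝ) → ℂ}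
    (h1 : ContDiff ℝ ∞ φ₁) (h2 : ContDiff ℝ ∞ φ₂) : ContDiff ℝ ∞ (tensorFun φ₁ φ₂) :=
  (h1.comp (reidx (Fin.castAdd d₂)).contDiff).mul (h2.comp (reidx (Fin.natAdd d₁)).contDiff)

theorem partialD_tensorFun_left {φ₁ : (Fin d₁ → ℝ) → ℂ} {φ₂ : (Fin d₂ → ℝ) → ℂ}
    (h1 : ContDiff ℝ ∞ φ₁) (h2 : ContDiff ℝ ∞ φ₂) (i : Fin d₁) :
    partialD (Fin.castAdd d₂ i) (tensorFun φ₁ φ₂) = tensorFun (partialD i φ₁) φ₂ := by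
  funext x
  have b1 : reidx (Fin.natAdd d₁) (Pi.single (Fin.castAdd d₂ i) 1) = 0 := by
    ext l
    have : Fin.natAdd d₁ l ≠ Fin.castAdd d₂ i := by
      intro h; have := congrArg Fin.val h; simp at this; omega
    simp [reidx, this]
  have b2 : reidx (Fin.castAdd d₂) (Pi.single (Fin.castAdd d₂ i) 1) = Pi.single i 1 := by
    ext l
    simp [reidx, Pi.single_apply]
  rw [partialD, hasFDerivAt_tensorFun h1 h2, b1, b2]
  simp [tensorFun, partialD, reidx]

theorem partialD_tensorFun_right {φ₁ : (Fin d₁ → ℝ) → ℂ} {φ₂ : (Fin d₂ → ℝ) → ℂ}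
    (h1 : ContDiff ℝ ∞ φ₁) (h2 : ContDiff ℝ ∞ φ₂) (j : Fin d₂) :
    partialD (Fin.natAdd d₁ j) (tensorFun φ₁ φ₂) = tensorFun φ₁ (partialD j φ₂) := by
  funext x
  have b1 : reidx (Fin.castAdd d₂) (Pi.single (Fin.natAdd d₁ j) 1) = 0 := by
    ext l
    have : Fin.castAdd d₂ l ≠ Fin.natAdd d₁ j := by
      intro h; have := congrArg Fin.val h; simp at this; omega
    simp [reidx, this]
  have b2 : reidx (Fin.natAdd d₁) (Pi.single (Fin.natAdd d₁ j) 1) = Pi.single j 1 := by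
    ext l
    simp [reidx, Pi.single_apply]
  rw [partialD, hasFDerivAt_tensorFun h1 h2, b1, b2]
  simp [tensorFun, partialD, reidx]

theorem multiD_tensorFun {φ₁ : (Fin d₁ → ℝ) → ℂ} {φ₂ : (Fin d₂ → ℝ) → ℂ}
    (h1 : ContDiff ℝ ∞ φ₁) (h2 : ContDiff ℝ ∞ φ₂) (α₁ : Fin d₁ → ℕ) (α₂ : Fin d₂ → ℕ) :
    multiD (Fin.append α₁ α₂) (tensorFun φ₁ φ₂) = tensorFun (multiD α₁ φ₁) (multiD α₂ φ₂) := by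
  have h3 : ContDiff ℝ ∞ (multiD α₂ φ₂) := contDiff_foldr _root_.id α₂ _ h2
  rw [multiD_append,
    foldr_comm (fun g => tensorFun φ₁ g) _root_.id (Fin.natAdd d₁) α₂
      (fun j _ hg => partialD_tensorFun_right h1 hg j) _ h2]
  exact foldr_comm (fun g => tensorFun g (multiD α₂ φ₂)) _root_.id (Fin.castAdd d₂) α₁
      (fun j _ hg => partialD_tensorFun_left hg h3 j) _ h1

theorem quot_tensorFun (s h : ℝ) {φ₁ : (Fin d₁ → ℝ) → ℂ} {φ₂ : (Fin d₂ → ℝ) → ℂ}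
    (h1 : ContDiff ℝ ∞ φ₁) (h2 : ContDiff ℝ ∞ φ₂) (α₁ β₁ : Fin d₁ → ℕ) (α₂ β₂ : Fin d₂ → ℕ)
    (x₁ : Fin d₁ → ℝ) (x₂ : Fin d₂ → ℝ) :
    quot s h (tensorFun φ₁ φ₂) (Fin.append α₁ α₂, Fin.append β₁ β₂, Fin.append x₁ x₂) =
      quot s h φ₁ (α₁, β₁, x₁) * quot s h φ₂ (α₂, β₂, x₂) := by
  have hw : weight s h (Fin.append α₁ α₂) (Fin.append β₁ β₂) =
      weight s h α₁ β₁ * weight s h α₂ β₂ := by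
    unfold weight
    simp only [Fin.sum_univ_add, Fin.prod_univ_add, Fin.append_left, Fin.append_right]
    rw [mul_mul_mul_comm (h ^ _), ← Real.mul_rpow (Nat.cast_nonneg _) (Nat.cast_nonneg _),
      ← pow_add]
    congr 2
    · ring
    · push_cast; ring
  have hm : monomial (Fin.append β₁ β₂) (Fin.append x₁ x₂) = monomial β₁ x₁ * monomial β₂ x₂ := by
    simp [monomial, Fin.prod_univ_add]
  simp only [quot, multiD_tensorFun h1 h2, hw, hm, tensorFun, Fin.append_left, Fin.append_right]
  rw [div_mul_div_comm, ← norm_mul]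
  push_cast
  congr 2
  ring

theorem tensorFun_mem {s : ℝ} {h} {φ₁ : (Fin d₁ → ℝ) → ℂ} {φ₂ : (Fin d₂ → ℝ) → ℂ}
    (h1 : φ₁ ∈ stepSub d₁ s h) (h2 : φ₂ ∈ stepSub d₂ s h) :
    tensorFun φ₁ φ₂ ∈ stepSub (d₁ + d₂) s h := by
  obtain ⟨c1, A, hA⟩ := h1
  obtain ⟨c2, B, hB⟩ := h2
  refine ⟨contDiff_tensorFun c1 c2, A * B, ?_⟩
  rintro _ ⟨⟨α, β, x⟩, rfl⟩
  rw [← Fin.append_castAdd_natAdd (f := α), ← Fin.append_castAdd_natAdd (f := β),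
    ← Fin.append_castAdd_natAdd (f := x), quot_tensorFun s h c1 c2]
  exact mul_le_mul (hA ⟨_, rfl⟩) (hB ⟨_, rfl⟩) (quot_nonneg s h.2 _ _)
    ((quot_nonneg s h.2 φ₁ (0, 0, 0)).trans (hA ⟨_, rfl⟩))

end Aux

/-- `φ₁ ⊗ φ₂ ∈ 𝒮_s(ℝ^{d₁+d₂})` for `φⱼ ∈ 𝒮_s(ℝ^{dⱼ})`. -/
def GS.tensor {d₁ d₂ : ℕ} {s : ℝ} (φ₁ : GS d₁ s) (φ₂ : GS d₂ s) : GS (d₁ + d₂) s :=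
  ⟨tensorFun φ₁ φ₂, by
    obtain ⟨h, hh⟩ := φ₁.2
    obtain ⟨k, hk⟩ := φ₂.2
    exact ⟨max h k, tensorFun_mem (stepSub_mono _ s (le_max_left h k) hh)
      (stepSub_mono _ s (le_max_right h k) hk)⟩⟩

/-- `φ(x₁, ·) ∈ 𝒮_s(ℝ^{d₂})` for `φ ∈ 𝒮_s(ℝ^{d₁+d₂})`. -/
def GS.fixFst {d₁ d₂ : ℕ} {s : ℝ} (φ : GS (d₁ + d₂) s) (x₁ : Fin d₁ → ℝ) : GS d₂ s :=
  ⟨GelfandShilov.fixFst x₁ φ, by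
    obtain ⟨h, hh⟩ := φ.2
    exact ⟨h, fixFst_mem x₁ hh⟩⟩

/-- `φ(·, x₂) ∈ 𝒮_s(ℝ^{d₁})` for `φ ∈ 𝒮_s(ℝ^{d₁+d₂})`. -/
def GS.fixSnd {d₁ d₂ : ℕ} {s : ℝ} (φ : GS (d₁ + d₂) s) (x₂ : Fin d₂ → ℝ) : GS d₁ s :=
  ⟨GelfandShilov.fixSnd x₂ φ, by
    obtain ⟨h, hh⟩ := φ.2
    exact ⟨h, fixSnd_mem x₂ hh⟩⟩

/-- `φ₁ ⊗ φ₂ ∈ Σ_s(ℝ^{d₁+d₂})` for `φⱼ ∈ Σ_s(ℝ^{dⱼ})`. -/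
def Sig.tensor {d₁ d₂ : ℕ} {s : ℝ} (φ₁ : Sig d₁ s) (φ₂ : Sig d₂ s) : Sig (d₁ + d₂) s :=
  ⟨tensorFun φ₁ φ₂, (Submodule.mem_iInf _).2 fun h =>
    tensorFun_mem ((Submodule.mem_iInf _).1 φ₁.2 h) ((Submodule.mem_iInf _).1 φ₂.2 h)⟩

/-- `φ(x₁, ·) ∈ Σ_s(ℝ^{d₂})` for `φ ∈ Σ_s(ℝ^{d₁+d₂})`. -/
def Sig.fixFst {d₁ d₂ : ℕ} {s : ℝ} (φ : Sig (d₁ + d₂) s) (x₁ : Fin d₁ → ℝ) : Sig d₂ s :=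
  ⟨GelfandShilov.fixFst x₁ φ, (Submodule.mem_iInf _).2 fun h =>
    fixFst_mem x₁ ((Submodule.mem_iInf _).1 φ.2 h)⟩

/-- `φ(·, x₂) ∈ Σ_s(ℝ^{d₁})` for `φ ∈ Σ_s(ℝ^{d₁+d₂})`. -/
def Sig.fixSnd {d₁ d₂ : ℕ} {s : ℝ} (φ : Sig (d₁ + d₂) s) (x₂ : Fin d₂ → ℝ) : Sig d₁ s :=
  ⟨GelfandShilov.fixSnd x₂ φ, (Submodule.mem_iInf _).2 fun h =>
    fixSnd_mem x₂ ((Submodule.mem_iInf _).1 φ.2 h)⟩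

/-- `f` is a tensor product of `f₁ ∈ 𝒮_s'(ℝ^{d₁})` and `f₂ ∈ 𝒮_s'(ℝ^{d₂})`:
`⟨f, φ₁ ⊗ φ₂⟩ = ⟨f₁, φ₁⟩ ⟨f₂, φ₂⟩`. -/
def GSDual.IsTensor {d₁ d₂ : ℕ} {s : ℝ} (f₁ : GSDual d₁ s) (f₂ : GSDual d₂ s)
    (f : GSDual (d₁ + d₂) s) : Prop :=
  ∀ (φ₁ : GS d₁ s) (φ₂ : GS d₂ s), f (φ₁.tensor φ₂) = f₁ φ₁ * f₂ φ₂

/-- `f` is a tensor product of `f₁ ∈ Σ_s'(ℝ^{d₁})` and `f₂ ∈ Σ_s'(ℝ^{d₂})`. -/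
def SigDual.IsTensor {d₁ d₂ : ℕ} {s : ℝ} (f₁ : SigDual d₁ s) (f₂ : SigDual d₂ s)
    (f : SigDual (d₁ + d₂) s) : Prop :=
  ∀ (φ₁ : Sig d₁ s) (φ₂ : Sig d₂ s), f (φ₁.tensor φ₂) = f₁ φ₁ * f₂ φ₂

end GelfandShilov

end

/-!
Existence is by iteration: `⟨f, φ⟩ = ⟨f₁, ⟨f₂, φ(x₁, ·)⟩⟩`. The point is that
`x₁ ↦ ⟨f₂, φ(x₁, ·)⟩` is again a test function (`pairing_mem`). For this `𝒮_{s,k}` is embedded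
isometrically into `ℓ^∞` by `u ↦ (x^β ∂^α u(x) / weight)`, and by Hahn-Banach a continuous
functional is, on `𝒮_{s,k}`, the restriction of a functional `Λ` on `ℓ^∞` (for every `k` in the case
of `𝒮_s'`, for some `k` in the case of `Σ_s'`). As an `ℓ^∞`-valued function, `x₁ ↦ φ(x₁, ·)` is
differentiable to all orders (`isDerivTower_slice`), because second order Taylor remainders are
uniformly controlled; and its derivatives satisfy the bounds of the space.

Uniqueness amounts to the density of the span of the tensor products: a functional `f` that
vanishes on all `φ₁ ⊗ φ₂` is zero. Gaussians `gauss b = exp (-b |x|²)` lie in `𝒮_s` for `s ≥ 1/2`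
and in `Σ_s` for `s > 1/2`, and so do their translates, which are tensor products. The convolution
of `φ` with `gauss b` is a superposition of translates of `gauss b`, on which `f` vanishes, and also
a superposition of translates of `φ`. Both are Bochner integrals in `ℓ^∞`, and they agree
(`integral_smul_emb_shift_comm`, integration by parts); hence `∫ gauss b y * ⟨f, φ(· - y)⟩ = 0`
for all `b > 0`. Here `⟨f, φ(· - y)⟩` is continuous and grows at most like `exp |y|²`, since `φ` and
`gauss 1` lie in a common step (`exists_translate_bound`). Letting `b → ∞` gives `⟨f, φ⟩ = 0`
(`eq_zero_of_gauss`).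

The second iterated formula follows from uniqueness: iterating in the other order, after exchange
of the two groups of variables, also defines a tensor product.
-/

namespace GelfandShilov

open scoped ContDiff ENNReal Topology
open MeasureTheory Filter

variable {d d' d₁ d₂ : ℕ}

/-! ### Towers of partial derivatives -/

/-- The linear map `v ↦ ∑ᵢ vᵢ cᵢ`, i.e. the Fréchet derivative whose partial derivatives are the
`cᵢ`. -/
noncomputable def gradCLM {F : Type*} [NormedAddCommGroup F] [NormedSpace ℝ F] (c : Fin d → F) :
    (Fin d → ℝ) →L[ℝ] F :=
  ∑ i, (ContinuousLinearMap.proj (R := ℝ) (φ := fun _ : Fin d => ℝ) i).smulRight (c i)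

section Tower

variable {F F' : Type*} [NormedAddCommGroup F] [NormedSpace ℝ F]
  [NormedAddCommGroup F'] [NormedSpace ℝ F']

theorem gradCLM_apply (c : Fin d → F) (v : Fin d → ℝ) : gradCLM c v = ∑ i, v i • c i := by
  simp [gradCLM]

theorem gradCLM_single (c : Fin d → F) (i : Fin d) : gradCLM c (Pi.single i 1) = c i := by
  rw [gradCLM_apply, Finset.sum_eq_single i]
  · simp
  · intro j _ hj; simp [hj]
  · simp

theorem norm_gradCLM_le (c : Fin d → F) : ‖gradCLM c‖ ≤ ∑ i, ‖c i‖ := by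
  refine ContinuousLinearMap.opNorm_le_bound _ (Finset.sum_nonneg fun _ _ => norm_nonneg _) ?_
  intro v
  rw [gradCLM_apply, Finset.sum_mul]
  refine (norm_sum_le _ _).trans (Finset.sum_le_sum fun i _ => ?_)
  rw [norm_smul, mul_comm]
  exact mul_le_mul_of_nonneg_left (norm_le_pi_norm v i) (norm_nonneg _)

theorem gradCLM_sub (c c' : Fin d → F) :
    gradCLM c - gradCLM c' = gradCLM (fun i => c i - c' i) := by
  ext v
  simp [gradCLM_apply, smul_sub]

theorem eq_gradCLM (L : (Fin d → ℝ) →L[ℝ] F) : L = gradCLM fun i => L (Pi.single i 1) := by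
  ext v
  rw [gradCLM_apply]
  conv_lhs => rw [pi_eq_sum_univ' v]
  simp [map_sum]

/-- A family `(G_α)` indexed by multi-indices such that `∂ᵢ G_α = G_{α + eᵢ}`, in the sense of
Fréchet derivatives. For smooth `u` the family `∂^α u` is one, and conversely every such family
is `G_α = ∂^α G₀`. -/
def IsDerivTower (G : (Fin d → ℕ) → (Fin d → ℝ) → F) : Prop :=
  ∀ α x, HasFDerivAt (G α) (gradCLM fun i => G (α + Pi.single i 1) x) x

theorem IsDerivTower.clm_comp {G : (Fin d → ℕ) → (Fin d → ℝ) → F} (hG : IsDerivTower G)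
    (L : F →L[ℝ] F') : IsDerivTower (fun α x => L (G α x)) := by
  intro α x
  have h : L ∘SL (gradCLM fun i => G (α + Pi.single i 1) x) =
      gradCLM fun i => L (G (α + Pi.single i 1) x) := by
    ext v
    simp [gradCLM_apply]
  exact h ▸ L.hasFDerivAt.comp x (hG α x)

theorem IsDerivTower.shift_index {G : (Fin d → ℕ) → (Fin d → ℝ) → F} (hG : IsDerivTower G)
    (β : Fin d → ℕ) : IsDerivTower (fun α => G (α + β)) := by
  intro α x
  simpa only [add_right_comm] using hG (α + β) x

theorem IsDerivTower.contDiff {G : (Fin d → ℕ) → (Fin d → ℝ) → F} (hG : IsDerivTower G)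
    (α : Fin d → ℕ) : ContDiff ℝ ∞ (G α) := by
  rw [contDiff_infty]
  intro n
  induction n generalizing α with
  | zero => exact contDiff_zero.2 (Differentiable.continuous fun x => (hG α x).differentiableAt)
  | succ n ih =>
    push_cast
    rw [contDiff_succ_iff_fderiv]
    refine ⟨fun x => (hG α x).differentiableAt, by simp, ?_⟩
    have : fderiv ℝ (G α) = fun x => gradCLM fun i => G (α + Pi.single i 1) x :=
      funext fun x => (hG α x).fderiv
    rw [this]
    unfold gradCLM
    exact ContDiff.sum fun i _ => contDiff_const.smulRight (ih _)

/-- Second order Taylor estimate. -/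
theorem norm_taylor_le {u : (Fin d → ℝ) → F} {c : Fin d → (Fin d → ℝ) → F}
    {e : Fin d → Fin d → (Fin d → ℝ) → F}
    (hu : ∀ x, HasFDerivAt u (gradCLM fun i => c i x) x)
    (hc : ∀ i x, HasFDerivAt (c i) (gradCLM fun j => e i j x) x)
    {M : Fin d → Fin d → ℝ} (hM : ∀ i j x, ‖e i j x‖ ≤ M i j) (x y : Fin d → ℝ) :
    ‖u y - u x - gradCLM (fun i => c i x) (y - x)‖ ≤
      (∑ i, ∑ j, M i j) * ‖y - x‖ * ‖y - x‖ := by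
  have hr : 0 ≤ ‖y - x‖ := norm_nonneg _
  refine Convex.norm_image_sub_le_of_norm_hasFDerivWithin_le'
    (s := Metric.closedBall x ‖y - x‖) (fun z _ => (hu z).hasFDerivWithinAt) ?_
    (convex_closedBall _ _) (Metric.mem_closedBall_self hr) (by simp [dist_eq_norm])
  intro z hz
  have hz' : ‖z - x‖ ≤ ‖y - x‖ := by simpa [dist_eq_norm] using hz
  rw [gradCLM_sub, Finset.sum_mul]
  refine (norm_gradCLM_le _).trans (Finset.sum_le_sum fun i _ => ?_)
  have hM0 : 0 ≤ ∑ j, M i j :=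
    Finset.sum_nonneg fun j _ => (norm_nonneg _).trans (hM i j x)
  refine (Convex.norm_image_sub_le_of_norm_hasFDerivWithin_le (𝕜 := ℝ) (s := Set.univ)
    (fun w _ => (hc i w).hasFDerivWithinAt) (fun w _ => ?_) convex_univ (Set.mem_univ x)
    (Set.mem_univ z)).trans (mul_le_mul_of_nonneg_left hz' hM0)
  exact (norm_gradCLM_le _).trans (Finset.sum_le_sum fun j _ => hM i j w)

end Tower

theorem hasFDerivAt_gradCLM {u : (Fin d → ℝ) → ℂ} (hu : ContDiff ℝ ∞ u) (x : Fin d → ℝ) :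
    HasFDerivAt u (gradCLM fun i => partialD i u x) x := by
  have h := (hu.differentiable (by simp) x).hasFDerivAt
  rwa [eq_gradCLM (fderiv ℝ u x)] at h

theorem partialD_comm {u : (Fin d → ℝ) → ℂ} (hu : ContDiff ℝ ∞ u) (i j : Fin d) :
    partialD i (partialD j u) = partialD j (partialD i u) := by
  funext x
  have h2 : ContDiff ℝ ∞ (fderiv ℝ u) := hu.fderiv_right (m := ∞) (by simp)
  have key : ∀ i j, partialD i (partialD j u) x =
      fderiv ℝ (fderiv ℝ u) x (Pi.single i 1) (Pi.single j 1) := by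
    intro i j
    unfold partialD
    have := ((h2.differentiable (by simp) x).hasFDerivAt.clm_apply
      (hasFDerivAt_const (Pi.single j (1 : ℝ)) x)).fderiv
    rw [this]
    simp
  rw [key, key]
  exact (hu.contDiffAt.isSymmSndFDerivAt (by simp; exact WithTop.coe_le_coe.2 le_top)) _ _

theorem contDiff_multiD (α : Fin d → ℕ) {u : (Fin d → ℝ) → ℂ} (hu : ContDiff ℝ ∞ u) :
    ContDiff ℝ ∞ (multiD α u) := contDiff_foldr _root_.id α _ hu

theorem multiD_zero (u : (Fin d → ℝ) → ℂ) : multiD 0 u = u :=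
  foldr_zero _root_.id _ u

theorem partialD_multiD {u : (Fin d → ℝ) → ℂ} (hu : ContDiff ℝ ∞ u) (i : Fin d) (α : Fin d → ℕ) :
    partialD i (multiD α u) = multiD (α + Pi.single i 1) u := by
  suffices H : ∀ l : List (Fin d), l.Nodup →
      l.foldr (fun j g => (partialD j)^[(α + Pi.single i 1 : Fin d → ℕ) j] g) u =
        if i ∈ l then partialD i (l.foldr (fun j g => (partialD j)^[α j] g) u)
        else l.foldr (fun j g => (partialD j)^[α j] g) u by
    have := H _ (List.nodup_finRange d)
    rw [if_pos (List.mem_finRange i)] at this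
    exact this.symm
  intro l hl
  induction l with
  | nil => simp
  | cons a l ih =>
    have hc : ContDiff ℝ ∞ (l.foldr (fun j g => (partialD j)^[α j] g) u) :=
      contDiff_foldr _root_.id α l hu
    rw [List.nodup_cons] at hl
    simp only [List.foldr_cons, ih hl.2, List.mem_cons]
    by_cases hia : i = a
    · subst hia
      rw [if_neg hl.1, if_pos (Or.inl rfl)]
      simp [Function.iterate_succ_apply']
    · by_cases hil : i ∈ l
      · rw [if_pos hil, if_pos (Or.inr hil)]
        simp only [Pi.add_apply, Pi.single_eq_of_ne (Ne.symm hia), add_zero]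
        exact iter_comm (partialD i) a a (fun g hg => partialD_comm hg _ _) _ hc
      · rw [if_neg hil, if_neg (by simp [hia, hil])]
        simp [Pi.single_eq_of_ne (Ne.symm hia)]

theorem isDerivTower_multiD {u : (Fin d → ℝ) → ℂ} (hu : ContDiff ℝ ∞ u) :
    IsDerivTower (fun α => multiD α u) := by
  intro α x
  simpa only [partialD_multiD hu] using hasFDerivAt_gradCLM (contDiff_multiD α hu) x

theorem IsDerivTower.partialD_eq {G : (Fin d → ℕ) → (Fin d → ℝ) → ℂ} (hG : IsDerivTower G)
    (α : Fin d → ℕ) (i : Fin d) : partialD i (G α) = G (α + Pi.single i 1) := by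
  funext x
  rw [partialD, (hG α x).fderiv, gradCLM_single]

theorem multiIndex_induction {P : (Fin d → ℕ) → Prop} (h0 : P 0)
    (h1 : ∀ α i, P α → P (α + Pi.single i 1)) (α : Fin d → ℕ) : P α := by
  induction hn : ∑ i, α i generalizing α with
  | zero =>
    have : α = 0 := funext fun i => by simpa using (Finset.sum_eq_zero_iff.1 hn) i
    rwa [this]
  | succ n ih =>
    obtain ⟨i, hi⟩ : ∃ i, α i ≠ 0 := by
      by_contra! h
      simp [h] at hn
    have hα : α = (α - Pi.single i 1) + Pi.single i 1 := by
      funext j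
      by_cases hj : j = i
      · subst hj; simp; omega
      · simp [hj]
    rw [hα]
    apply h1
    apply ih
    have : ∑ j, α j = ∑ j, (α - Pi.single i 1 : Fin d → ℕ) j + 1 := by
      conv_lhs => rw [hα]
      simp only [Pi.add_apply (f := α - Pi.single i 1), Finset.sum_add_distrib,
        Finset.sum_pi_single', Finset.mem_univ, if_true]
    omega

theorem IsDerivTower.multiD_eq {G : (Fin d → ℕ) → (Fin d → ℝ) → ℂ} (hG : IsDerivTower G)
    (α : Fin d → ℕ) : multiD α (G 0) = G α := by
  induction α using multiIndex_induction with
  | h0 => exact multiD_zero _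
  | h1 α i ih => rw [← partialD_multiD (hG.contDiff 0), ih, hG.partialD_eq]

theorem multiD_multiD {u : (Fin d → ℝ) → ℂ} (hu : ContDiff ℝ ∞ u) (α β : Fin d → ℕ) :
    multiD α (multiD β u) = multiD (α + β) u := by
  have := ((isDerivTower_multiD hu).shift_index β).multiD_eq α
  simpa using this

theorem multiD_partialD {u : (Fin d → ℝ) → ℂ} (hu : ContDiff ℝ ∞ u) (i : Fin d) (α : Fin d → ℕ) :
    multiD α (partialD i u) = multiD (α + Pi.single i 1) u := by
  rw [← multiD_multiD hu, ← zero_add (Pi.single i 1 : Fin d → ℕ), ← partialD_multiD hu, multiD_zero]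

/-- A function in `𝒮_{s,h}(ℝᵈ)` as an element of the normed space. -/
def Step.of {s : ℝ} {h : {h : ℝ // 0 < h}} {u : (Fin d → ℝ) → ℂ} (hu : u ∈ stepSub d s h) :
    Step d s h := ⟨u, hu⟩

/-! ### The isometric embedding of `𝒮_{s,h}` into `ℓ^∞` -/

/-- The space of bounded families indexed by `(α, β, x)`. -/
abbrev Ell (d : ℕ) : Type :=
  lp (fun _ : (Fin d → ℕ) × (Fin d → ℕ) × (Fin d → ℝ) => ℂ) ∞

/-- A bounded family as an element of `ℓ^∞`. -/
def ellOfBound (c : (Fin d → ℕ) × (Fin d → ℕ) × (Fin d → ℝ) → ℂ) (A : ℝ) (hA : ∀ p, ‖c p‖ ≤ A) :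
    Ell d :=
  ⟨c, memℓp_infty ⟨A, by rintro _ ⟨p, rfl⟩; exact hA p⟩⟩

theorem evalCLM_ell {𝕜 : Type*} [NormedRing 𝕜] [Module 𝕜 ℂ] [IsBoundedSMul 𝕜 ℂ] (v : Ell d) (p) :
    lp.evalCLM 𝕜 (fun _ => ℂ) ∞ p v = v p := by
  simp [lp.evalCLM]

/-- The family `x^β ∂^α u(x) / (h^{|α|+|β|} (α! β!)^s)`. -/
noncomputable def coord (s h : ℝ) (u : (Fin d → ℝ) → ℂ)
    (p : (Fin d → ℕ) × (Fin d → ℕ) × (Fin d → ℝ)) : ℂ :=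
  (monomial p.2.1 p.2.2 : ℂ) * multiD p.1 u p.2.2 / (weight s h p.1 p.2.1 : ℂ)

theorem norm_coord (s : ℝ) {h : ℝ} (hh : 0 < h) (u : (Fin d → ℝ) → ℂ) (p) :
    ‖coord s h u p‖ = quot s h u p := by
  rw [coord, quot, norm_div, Complex.norm_real, Real.norm_of_nonneg (weight_pos s hh _ _).le]

/-- The isometric embedding `𝒮_{s,h}(ℝᵈ) → ℓ^∞`, `u ↦ (x^β ∂^α u(x) / weight)`. -/
noncomputable def Step.emb (d : ℕ) (s : ℝ) (h : {h : ℝ // 0 < h}) : Step d s h →ₗᵢ[ℂ] Ell d where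
  toFun u := ⟨coord s h u.1, memℓp_infty (by
    have := u.2.2
    simpa only [norm_coord s h.2] using this)⟩
  map_add' u v := by
    ext p
    change coord s h (u.1 + v.1) p = coord s h u.1 p + coord s h v.1 p
    simp only [coord, multiD_add p.1 u.2.1 v.2.1, Pi.add_apply]
    ring
  map_smul' c u := by
    ext p
    change coord s h (c • u.1) p = c • coord s h u.1 p
    simp only [coord, multiD_smul p.1 c u.2.1, Pi.smul_apply, smul_eq_mul]
    ring
  norm_map' u := by
    rw [lp.norm_eq_ciSup, Step.norm_def]
    exact congrArg iSup (funext fun p => norm_coord s h.2 u.1 p)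

theorem Step.norm_le {s : ℝ} {h : {h : ℝ // 0 < h}} (u : Step d s h) {A : ℝ}
    (hA : ∀ p, quot s h u.1 p ≤ A) : ‖u‖ ≤ A := ciSup_le hA

theorem Step.quot_le_norm {s : ℝ} {h : {h : ℝ // 0 < h}} (u : Step d s h) (p) :
    quot s h u.1 p ≤ ‖u‖ := le_ciSup u.2.2 p

/-! ### Continuous functionals extend to `ℓ^∞` -/

/-- Hahn-Banach theorem for a linear functional that is continuous with respect to the norm
induced by an injective linear map into a normed space. -/
theorem exists_clm_comp_eq {V F : Type*} [AddCommGroup V] [Module ℂ V] [NormedAddCommGroup F]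
    [NormedSpace ℂ F] (T : V →ₗ[ℂ] F) (hT : Function.Injective T) (f : V →ₗ[ℂ] ℂ)
    (hf : Tendsto f (comap T (𝓝 0)) (𝓝 0)) : ∃ Λ : F →L[ℂ] ℂ, ∀ v, Λ (T v) = f v := by
  let e := LinearEquiv.ofInjective T hT
  have he : ∀ v, ((e v : LinearMap.range T) : F) = T v := fun v => rfl
  let g : LinearMap.range T →ₗ[ℂ] ℂ := f ∘ₗ (e.symm : LinearMap.range T →ₗ[ℂ] V)
  have hg : ContinuousAt g 0 := by
    rw [ContinuousAt, map_zero]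
    refine hf.comp ?_
    rw [tendsto_comap_iff]
    have : (T ∘ (e.symm : LinearMap.range T → V)) = Subtype.val := by
      funext w
      simp [← he]
    change Tendsto (T ∘ (e.symm : LinearMap.range T → V)) _ _
    rw [this]
    exact continuous_subtype_val.tendsto' _ _ rfl
  have hg' : Continuous g := continuous_of_continuousAt_zero g hg
  obtain ⟨Λ, hΛ, -⟩ := exists_extension_norm_eq (LinearMap.range T) ⟨g, hg'⟩
  refine ⟨Λ, fun v => ?_⟩
  have h1 := hΛ (e v)
  rw [he] at h1
  rw [h1]
  simp [g]

theorem comap_emb_nhds_zero (d : ℕ) (s : ℝ) (h : {h : ℝ // 0 < h}) :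
    comap (Step.emb d s h) (𝓝 0) = 𝓝 0 := by
  rw [(Step.emb d s h).isometry.isUniformInducing.isInducing.nhds_eq_comap, map_zero]

theorem continuous_stepToGS (d : ℕ) (s : ℝ) (h : {h : ℝ // 0 < h}) :
    Continuous (stepToGS d s h) :=
  continuous_iff_coinduced_le.2 (le_iSup (fun h => TopologicalSpace.coinduced (stepToGS d s h)
      inferInstance) h)

/-- A continuous functional on `𝒮_s` is bounded on every `𝒮_{s,h}`. -/
theorem GSDual.exists_ell {s : ℝ} (f : GSDual d s) (h : {h : ℝ // 0 < h}) :
    ∃ Λ : Ell d →L[ℂ] ℂ, ∀ u : Step d s h, Λ (Step.emb d s h u) = f (stepToGS d s h u) := by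
  refine exists_clm_comp_eq (Step.emb d s h).toLinearMap (Step.emb d s h).injective
    ((f : GS d s →ₗ[ℂ] ℂ) ∘ₗ stepToGS d s h) ?_
  change Tendsto (f ∘ stepToGS d s h) (comap (Step.emb d s h) (𝓝 0)) _
  rw [comap_emb_nhds_zero]
  exact (f.continuous.comp (continuous_stepToGS d s h)).tendsto' _ _ (by simp)

theorem GS.continuous_of_step {s : ℝ} {Y : Type*} [TopologicalSpace Y] {f : GS d s → Y}
    (hf : ∀ h, Continuous fun u : Step d s h => f (stepToGS d s h u)) : Continuous f :=
  continuous_iSup_dom.2 fun h => continuous_coinduced_dom.2 (hf h)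

theorem continuous_sigToStep (d : ℕ) (s : ℝ) (h : {h : ℝ // 0 < h}) :
    Continuous (sigToStep d s h) :=
  continuous_iff_le_induced.2 (iInf_le (fun h => TopologicalSpace.induced (sigToStep d s h)
      inferInstance) h)

theorem sigToStep_injective (d : ℕ) (s : ℝ) (h : {h : ℝ // 0 < h}) :
    Function.Injective (sigToStep d s h) := by
  intro u v huv
  exact Subtype.ext (congrArg (fun w : Step d s h => w.1) huv)

/-- The norms of the `𝒮_{s,h}` are directed, so a continuous functional on `Σ_s` is bounded by a
multiple of a single one of them. -/
theorem SigDual.exists_ell {s : ℝ} (f : SigDual d s) :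
    ∃ (h : {h : ℝ // 0 < h}) (Λ : Ell d →L[ℂ] ℂ),
      ∀ u : Sig d s, Λ (Step.emb d s h (sigToStep d s h u)) = f u := by
  have hf : Tendsto f (𝓝 0) (𝓝 0) := f.continuous.tendsto' _ _ (by simp)
  have hn : 𝓝 (0 : Sig d s) = ⨅ h, comap (sigToStep d s h) (𝓝 0) := by
    rw [show (instTopologicalSpaceSig d s) =
      ⨅ h, TopologicalSpace.induced (sigToStep d s h) inferInstance from rfl, nhds_iInf]
    refine iInf_congr fun h => ?_
    rw [nhds_induced, map_zero]
  have hdir : Directed (· ≥ ·) fun h => comap (sigToStep d s h) (𝓝 0) := by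
    have hm : ∀ h k : {h : ℝ // 0 < h}, h ≤ k →
        comap (sigToStep d s h) (𝓝 0) ≤ comap (sigToStep d s k) (𝓝 0) := by
      intro h k hk
      rw [← tendsto_iff_comap]
      refine squeeze_zero_norm (a := fun u : Sig d s => ‖sigToStep d s h u‖) (fun u => ?_)
        (tendsto_zero_iff_norm_tendsto_zero.1 tendsto_comap)
      exact Step.norm_le _ fun p => (quot_anti s h.2 hk _ p).trans
        (Step.quot_le_norm (sigToStep d s h u) p)
    intro h k
    exact ⟨min h k, hm _ _ (min_le_left _ _), hm _ _ (min_le_right _ _)⟩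
  have : Nonempty {h : ℝ // 0 < h} := ⟨⟨1, one_pos⟩⟩
  have h1 : {u : Sig d s | ‖f u‖ < 1} ∈ 𝓝 (0 : Sig d s) := by
    have := hf.norm
    rw [norm_zero] at this
    exact this.eventually (gt_mem_nhds one_pos)
  rw [hn, mem_iInf_of_directed hdir] at h1
  obtain ⟨h, hh⟩ := h1
  refine ⟨h, exists_clm_comp_eq ((Step.emb d s h).toLinearMap ∘ₗ sigToStep d s h)
    ((Step.emb d s h).injective.comp (sigToStep_injective d s h)) (f : Sig d s →ₗ[ℂ] ℂ) ?_⟩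
  have hco : comap ((Step.emb d s h).toLinearMap ∘ₗ sigToStep d s h) (𝓝 0) =
      comap (sigToStep d s h) (𝓝 0) := by
    rw [← comap_emb_nhds_zero, comap_comap]
    rfl
  rw [hco, Metric.tendsto_nhds]
  intro ε hε
  rw [mem_comap] at hh
  obtain ⟨t, ht, hts⟩ := hh
  have h2 : ∀ᶠ v in 𝓝 (0 : Step d s h), ((2 / ε : ℝ) : ℂ) • v ∈ t :=
    (continuous_const_smul ((2 / ε : ℝ) : ℂ)).tendsto' _ _ (smul_zero _) ht
  filter_upwards [preimage_mem_comap h2] with u hu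
  have h3 : ‖f (((2 / ε : ℝ) : ℂ) • u)‖ < 1 := hts (by
    change sigToStep d s h _ ∈ t
    rw [map_smul]; exact hu)
  rw [map_smul, norm_smul, Complex.norm_real, Real.norm_of_nonneg (by positivity)] at h3
  rw [dist_zero_right]
  change ‖f u‖ < ε
  have h4 := norm_nonneg (f u)
  rw [div_mul_eq_mul_div, div_lt_one hε] at h3
  linarith

/-! ### Pairing in one group of variables -/

theorem weight_append (s h : ℝ) (α₁ β₁ : Fin d₁ → ℕ) (α₂ β₂ : Fin d₂ → ℕ) :
    weight s h (Fin.append α₁ α₂) (Fin.append β₁ β₂) =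
      weight s h α₁ β₁ * weight s h α₂ β₂ := by
  unfold weight
  simp only [Fin.sum_univ_add, Fin.prod_univ_add, Fin.append_left, Fin.append_right]
  rw [mul_mul_mul_comm (h ^ _), ← Real.mul_rpow (Nat.cast_nonneg _) (Nat.cast_nonneg _),
    ← pow_add]
  congr 2
  · ring
  · push_cast; ring

theorem monomial_append (β₁ : Fin d₁ → ℕ) (β₂ : Fin d₂ → ℕ) (x₁ : Fin d₁ → ℝ) (x₂ : Fin d₂ → ℝ) :
    monomial (Fin.append β₁ β₂) (Fin.append x₁ x₂) = monomial β₁ x₁ * monomial β₂ x₂ := by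
  simp [monomial, Fin.prod_univ_add]

theorem monomial_zero (x : Fin d → ℝ) : monomial 0 x = 1 := by simp [monomial]

theorem weight_zero (s h : ℝ) : weight s h (0 : Fin d → ℕ) 0 = 1 := by simp [weight]

/-- The weighted coordinates of `∂₁^α φ(x₁, ·)`. -/
noncomputable def sliceCoord (s k : ℝ) (φ : (Fin (d₁ + d₂) → ℝ) → ℂ) (α : Fin d₁ → ℕ)
    (x₁ : Fin d₁ → ℝ) (p : (Fin d₂ → ℕ) × (Fin d₂ → ℕ) × (Fin d₂ → ℝ)) : ℂ :=
  (monomial p.2.1 p.2.2 : ℂ) * multiD (Fin.append α p.1) φ (Fin.append x₁ p.2.2) /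
    (weight s k p.1 p.2.1 : ℂ)

section Slice

variable {s : ℝ} {m k : ℝ} {φ : (Fin (d₁ + d₂) → ℝ) → ℂ} {A : ℝ}

/-- The multi-indices `(α, β)` in the first group of variables are paid for by the step `m`, which
leaves the part of the weight belonging to the second group. -/
theorem norm_monomial_mul_sliceCoord_le (hm : 0 < m) (hmk : m ≤ k)
    (hA : ∀ p, quot s m φ p ≤ A) (α β : Fin d₁ → ℕ) (x₁ : Fin d₁ → ℝ) (p) :
    ‖(monomial β x₁ : ℂ) * sliceCoord (d₂ := d₂) s k φ α x₁ p‖ ≤ A * weight s m α β := by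
  have h1 := hA (Fin.append α p.1, Fin.append β p.2.1, Fin.append x₁ p.2.2)
  have hk := hm.trans_le hmk
  have w1 := weight_pos s hm α β
  have w2 := weight_pos s hm p.1 p.2.1
  have w3 := weight_pos s hk p.1 p.2.1
  have w4 := weight_mono s hm hmk p.1 p.2.1
  simp only [quot, weight_append, monomial_append] at h1
  rw [div_le_iff₀ (by positivity)] at h1
  have hA0 : 0 ≤ A := (quot_nonneg s hm φ (0, 0, 0)).trans (hA _)
  rw [sliceCoord, ← mul_div_assoc, norm_div, Complex.norm_real, Real.norm_of_nonneg w3.le,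
    div_le_iff₀ w3, ← mul_assoc, ← Complex.ofReal_mul]
  refine h1.trans ?_
  rw [← mul_assoc]
  gcongr

theorem norm_sliceCoord_le (hm : 0 < m) (hmk : m ≤ k)
    (hA : ∀ p, quot s m φ p ≤ A) (α : Fin d₁ → ℕ) (x₁ : Fin d₁ → ℝ) (p) :
    ‖sliceCoord (d₂ := d₂) s k φ α x₁ p‖ ≤ A * weight s m α 0 := by
  simpa [monomial_zero] using norm_monomial_mul_sliceCoord_le hm hmk hA α 0 x₁ p

/-- For fixed `x₁`, the coordinates of `∂₁^α φ(x₁, ·)` as an element of `ℓ^∞`. -/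
noncomputable def slice (hm : 0 < m) (hmk : m ≤ k) (hA : ∀ p, quot s m φ p ≤ A)
    (α : Fin d₁ → ℕ) (x₁ : Fin d₁ → ℝ) : Ell d₂ :=
  ellOfBound (sliceCoord s k φ α x₁) _ (norm_sliceCoord_le hm hmk hA α x₁)

/-- With `p = (α₂, β₂, x₂)` fixed, the coordinate is a multiple of `∂₁^α` of the smooth function
`∂₂^{α₂} φ(·, x₂)`. -/
theorem isDerivTower_sliceCoord (hφ : ContDiff ℝ ∞ φ) (s k : ℝ) (p) :
    IsDerivTower fun α x₁ => sliceCoord (d₁ := d₁) (d₂ := d₂) s k φ α x₁ p := by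
  have h1 := (isDerivTower_multiD (contDiff_fixSnd p.2.2
    (contDiff_multiD (Fin.append 0 p.1) hφ))).clm_comp
    (ContinuousLinearMap.mul ℝ ℂ ((monomial p.2.1 p.2.2 : ℂ) / (weight s k p.1 p.2.1 : ℂ)))
  have h2 : ∀ α : Fin d₁ → ℕ, Fin.append α 0 + Fin.append 0 p.1 = Fin.append α p.1 := by
    intro α
    funext i
    refine Fin.addCases (fun i => ?_) (fun i => ?_) i <;> simp
  convert h1 using 3 with α x₁
  rw [multiD_fixSnd _ (contDiff_multiD _ hφ), multiD_multiD hφ, h2]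
  simp only [sliceCoord, fixSnd, ContinuousLinearMap.mul_apply']
  ring

/-- `x₁ ↦ ∂₁^α φ(x₁, ·)` is differentiable as a map into `ℓ^∞`: the second order Taylor
remainder, coordinate by coordinate, is controlled by `∂₁^{α + eᵢ + eⱼ} φ`. -/
theorem isDerivTower_slice (hφ : ContDiff ℝ ∞ φ) (hm : 0 < m) (hmk : m ≤ k)
    (hA : ∀ p, quot s m φ p ≤ A) :
    IsDerivTower fun α x₁ => slice (d₁ := d₁) (d₂ := d₂) hm hmk hA α x₁ := by
  intro α x
  set K : ℝ := ∑ i, ∑ j, A * weight s m (α + Pi.single i 1 + Pi.single j 1) 0 with hK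
  have hA0 : 0 ≤ A := (quot_nonneg s hm φ (0, 0, 0)).trans (hA _)
  have hK0 : 0 ≤ K := Finset.sum_nonneg fun i _ => Finset.sum_nonneg fun j _ =>
    mul_nonneg hA0 (weight_pos s hm _ _).le
  have key : ∀ y, ‖slice (d₂ := d₂) hm hmk hA α y - slice hm hmk hA α x -
      gradCLM (fun i => slice hm hmk hA (α + Pi.single i 1) x) (y - x)‖ ≤
        K * ‖y - x‖ * ‖y - x‖ := by
    intro y
    refine lp.norm_le_of_forall_le (by positivity) fun p => ?_
    have ht := isDerivTower_sliceCoord (d₁ := d₁) (d₂ := d₂) hφ s k p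
    have := norm_taylor_le (u := fun x₁ => sliceCoord s k φ α x₁ p)
      (c := fun i x₁ => sliceCoord s k φ (α + Pi.single i 1) x₁ p)
      (e := fun i j x₁ => sliceCoord s k φ (α + Pi.single i 1 + Pi.single j 1) x₁ p)
      (fun z => ht α z) (fun i z => ht (α + Pi.single i 1) z)
      (fun i j z => norm_sliceCoord_le hm hmk hA _ z p) x y
    rw [← evalCLM_ell (𝕜 := ℝ)]
    rw [gradCLM_apply] at this ⊢
    simp only [map_sub, map_sum, map_smul, evalCLM_ell]
    exact this
  rw [hasFDerivAt_iff_isLittleO]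
  refine Asymptotics.IsLittleO.of_bound fun c hc => ?_
  have h0 : Tendsto (fun y => K * ‖y - x‖) (𝓝 x) (𝓝 0) :=
    (by fun_prop : Continuous fun y => K * ‖y - x‖).tendsto' _ _ (by simp)
  filter_upwards [h0.eventually (gt_mem_nhds hc)] with y hy
  exact (key y).trans (mul_le_mul_of_nonneg_right hy.le (norm_nonneg _))

end Slice

/-- Pairing `φ(x₁, ·)` with a functional on `𝒮_{s,k}` gives a function in `𝒮_{s,m}` when
`φ ∈ 𝒮_{s,m}` and `m ≤ k`. -/
theorem pairing_mem {s : ℝ} {m k : {h : ℝ // 0 < h}} (hmk : m ≤ k) (Λ : Ell d₂ →L[ℂ] ℂ)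
    {φ : (Fin (d₁ + d₂) → ℝ) → ℂ} (hφ : ContDiff ℝ ∞ φ) {A : ℝ} (hA : ∀ p, quot s m φ p ≤ A)
    {g : (Fin d₁ → ℝ) → ℂ}
    (hg : ∀ x₁, ∃ hx : fixFst x₁ φ ∈ stepSub d₂ s k, g x₁ = Λ (Step.emb d₂ s k (.of hx))) :
    ContDiff ℝ ∞ g ∧ ∀ p, quot s m g p ≤ ‖Λ‖ * A := by
  have hT := (isDerivTower_slice (d₁ := d₁) (d₂ := d₂) hφ m.2 hmk hA).clm_comp
    (Λ.restrictScalars ℝ)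
  have hg' : g = fun x₁ => Λ (slice (d₁ := d₁) (d₂ := d₂) m.2 hmk hA 0 x₁) := by
    funext x₁
    obtain ⟨hx, h1⟩ := hg x₁
    rw [h1]
    congr 1
    ext p
    change coord s k (fixFst x₁ φ) p = sliceCoord s k φ 0 x₁ p
    simp only [coord, multiD_fixFst x₁ hφ]
    rfl
  refine ⟨hg' ▸ hT.contDiff 0, ?_⟩
  rintro ⟨α, β, x⟩
  have h2 : multiD α g x = Λ (slice (d₁ := d₁) (d₂ := d₂) m.2 hmk hA α x) := by
    rw [hg']
    exact congrFun (hT.multiD_eq α) x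
  rw [quot, div_le_iff₀ (weight_pos s m.2 _ _)]
  simp only [h2]
  rw [← smul_eq_mul, ← map_smul, mul_assoc]
  refine (Λ.le_opNorm _).trans (mul_le_mul_of_nonneg_left ?_ (norm_nonneg _))
  refine lp.norm_le_of_forall_le (mul_nonneg ((quot_nonneg s m.2 φ (0, 0, 0)).trans (hA _))
    (weight_pos s m.2 _ _).le) fun p => ?_
  exact norm_monomial_mul_sliceCoord_le m.2 hmk hA α β x p

/-! ### Weights and decay -/

/-- From `(m + n)! ≤ 2^{m+n} m! n!`: a shift of the multi-indices costs a factor `2^s` in the step.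
Both the decay of `(1 + |y|)^N u` and the stability under `∂ᵢ` rest on this. -/
theorem weight_add_le {s : ℝ} (hs : 0 ≤ s) {h : ℝ} (hh : 0 < h) (α α' β β' : Fin d → ℕ) :
    weight s h (α + α') (β + β') ≤
      weight s (2 ^ s * h) α β * weight s (2 ^ s * h) α' β' := by
  have hf : ∀ a b : Fin d → ℕ, ∏ i, ((a + b) i).factorial ≤
      2 ^ (∑ i, (a + b) i) * ((∏ i, (a i).factorial) * ∏ i, (b i).factorial) := by
    intro a b
    rw [← Finset.prod_pow_eq_pow_sum, ← Finset.prod_mul_distrib, ← Finset.prod_mul_distrib]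
    refine Finset.prod_le_prod' fun i _ => ?_
    rw [Pi.add_apply, ← Nat.add_choose_mul_factorial_mul_factorial, mul_assoc]
    exact Nat.mul_le_mul_right _ (Nat.choose_le_two_pow _ _)
  set n := (∑ i, (α + α') i) + ∑ i, (β + β') i with hn
  have hn' : ((∑ i, α i) + ∑ i, β i) + ((∑ i, α' i) + ∑ i, β' i) = n := by
    simp only [hn, Pi.add_apply, Finset.sum_add_distrib]; ring
  have h1 : weight s (2 ^ s * h) α β * weight s (2 ^ s * h) α' β' =
      h ^ n * (((2 : ℝ) ^ n * ((((∏ i, (α i).factorial) * ∏ i, (β i).factorial : ℕ) : ℝ) *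
        (((∏ i, (α' i).factorial) * ∏ i, (β' i).factorial : ℕ) : ℝ))) ^ s) := by
    unfold weight
    rw [mul_mul_mul_comm, ← pow_add, hn', ← Real.mul_rpow (Nat.cast_nonneg _) (Nat.cast_nonneg _),
      mul_pow, Real.mul_rpow (x := (2 : ℝ) ^ n) (by positivity) (by positivity),
      ← Real.rpow_natCast (2 ^ s),
      ← Real.rpow_mul (by norm_num), mul_comm s, Real.rpow_mul (by norm_num), Real.rpow_natCast]
    ring
  rw [h1, weight, ← hn]
  refine mul_le_mul_of_nonneg_left (Real.rpow_le_rpow (Nat.cast_nonneg _) ?_ hs) (by positivity)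
  have h2 := Nat.mul_le_mul (hf α α') (hf β β')
  have h3 : ((2 : ℝ) ^ n * ((((∏ i, (α i).factorial) * ∏ i, (β i).factorial : ℕ) : ℝ) *
        (((∏ i, (α' i).factorial) * ∏ i, (β' i).factorial : ℕ) : ℝ))) =
      ((2 ^ (∑ i, (α + α') i) * ((∏ i, (α i).factorial) * ∏ i, (α' i).factorial) *
      (2 ^ (∑ i, (β + β') i) * ((∏ i, (β i).factorial) * ∏ i, (β' i).factorial)) : ℕ) : ℝ) := by
    rw [hn, pow_add]; push_cast; ring
  rw [h3]
  exact_mod_cast h2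

theorem weight_mul_of_factorial (s h : ℝ) {α β γ δ : Fin d → ℕ} (hβ : δ + γ = β)
    (hf : (∏ i, (δ i).factorial) * ∏ i, (γ i).factorial = ∏ i, (β i).factorial) :
    weight s h 0 δ * weight s h α γ = weight s h α β := by
  unfold weight
  rw [mul_mul_mul_comm, ← pow_add, ← Real.mul_rpow (Nat.cast_nonneg _) (Nat.cast_nonneg _),
    ← Nat.cast_mul, ← hf, ← hβ]
  congr 2
  · simp only [Pi.zero_apply, Finset.sum_const_zero, Pi.add_apply, Finset.sum_add_distrib]; ring
  · congr 1
    simp only [Pi.zero_apply, Nat.factorial_zero, Finset.prod_const_one]; ring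

theorem two_pow_mul_weight_le (s : ℝ) {h : ℝ} (hh : 0 < h) (α β : Fin d → ℕ) :
    2 ^ (∑ i, β i) * weight s h α β ≤ weight s (2 * h) α β := by
  unfold weight
  rw [← mul_assoc, mul_pow 2 h]
  gcongr
  · norm_num
  · omega

theorem one_le_two_rpow {s : ℝ} (hs : 0 ≤ s) : (1 : ℝ) ≤ 2 ^ s :=
  Real.one_le_rpow (by norm_num) hs

theorem two_mul_rpow_le {s : ℝ} (hs : 0 ≤ s) {h k : {h : ℝ // 0 < h}}
    (hk : 2 * (2 ^ s * (2 ^ s * (h : ℝ))) ≤ k) : 2 * (2 ^ s * (h : ℝ)) ≤ k := by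
  have h2 := one_le_two_rpow hs
  have h3 : 0 ≤ 2 ^ s * (h : ℝ) := mul_nonneg (by positivity) h.2.le
  nlinarith

/-- In each coordinate the larger one of `|yᵢ|` and `|xᵢ - yᵢ|` is at least `|xᵢ| / 2`; the
monomial `x^β` is distributed accordingly. -/
theorem exists_monomial_le (β : Fin d → ℕ) (x y : Fin d → ℝ) :
    ∃ δ γ : Fin d → ℕ, δ + γ = β ∧
      (∏ i, (δ i).factorial) * ∏ i, (γ i).factorial = ∏ i, (β i).factorial ∧
      |monomial β x| ≤ 2 ^ (∑ i, β i) * (|monomial δ y| * |monomial γ (x - y)|) := by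
  classical
  refine ⟨fun i => if |x i - y i| ≤ |y i| then β i else 0,
    fun i => if |x i - y i| ≤ |y i| then 0 else β i, ?_, ?_, ?_⟩
  · funext i
    simp only [Pi.add_apply]
    split_ifs <;> simp
  · rw [← Finset.prod_mul_distrib]
    refine Finset.prod_congr rfl fun i _ => ?_
    by_cases h : |x i - y i| ≤ |y i| <;> simp [h]
  · unfold monomial
    rw [Finset.abs_prod, Finset.abs_prod, Finset.abs_prod, ← Finset.prod_mul_distrib,
      ← Finset.prod_pow_eq_pow_sum, ← Finset.prod_mul_distrib]
    refine Finset.prod_le_prod (fun i _ => abs_nonneg _) fun i _ => ?_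
    have h1 : |x i| ≤ |y i| + |x i - y i| := by
      simpa using abs_add_le (y i) (x i - y i)
    simp only [abs_pow, Pi.sub_apply]
    split_ifs with h
    · rw [pow_zero, mul_one, ← mul_pow]
      exact pow_le_pow_left₀ (abs_nonneg _) (by linarith) _
    · rw [pow_zero, one_mul, ← mul_pow]
      exact pow_le_pow_left₀ (abs_nonneg _) (by linarith) _

theorem monomial_add (β γ : Fin d → ℕ) (x : Fin d → ℝ) :
    monomial (β + γ) x = monomial β x * monomial γ x := by
  simp [monomial, pow_add, Finset.prod_mul_distrib]

theorem monomial_single (i : Fin d) (n : ℕ) (x : Fin d → ℝ) :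
    monomial (Pi.single i n) x = x i ^ n := by
  unfold monomial
  rw [Finset.prod_eq_single i]
  · simp
  · intro j _ hj; simp [hj]
  · simp

theorem one_add_norm_pow_mul_le {s : ℝ} (hs : 0 ≤ s) {h : ℝ} (hh : 0 < h)
    {u : (Fin d → ℝ) → ℂ} {A : ℝ} (hu : ∀ β y, |monomial β y| * ‖u y‖ ≤ A * weight s h 0 β)
    (N : ℕ) : ∃ C, 0 ≤ C ∧ ∀ β y,
      (1 + ‖y‖) ^ N * (|monomial β y| * ‖u y‖) ≤ C * weight s (2 ^ s * h) 0 β := by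
  have hA : 0 ≤ A := by
    have := hu 0 0
    rw [weight_zero, mul_one] at this
    exact (by positivity : (0:ℝ) ≤ _).trans this
  have h2 := one_le_two_rpow hs
  have hle : h ≤ 2 ^ s * h := le_mul_of_one_le_left hh.le h2
  have hh' : 0 < 2 ^ s * h := by positivity
  set S : ℝ := ∑ i : Fin d, weight s (2 ^ s * h) 0 (Pi.single i N) with hS
  have hS0 : ∀ i ∈ Finset.univ,
      0 ≤ weight s (2 ^ s * h) 0 (Pi.single (M := fun _ : Fin d => ℕ) i N) :=
    fun i _ => (weight_pos s hh' _ _).le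
  have hS1 : 0 ≤ S := Finset.sum_nonneg hS0
  refine ⟨2 ^ N * A * (1 + S), by positivity, fun β y => ?_⟩
  have hw := weight_pos s hh' 0 β
  by_cases hy : ‖y‖ ≤ 1
  · calc (1 + ‖y‖) ^ N * (|monomial β y| * ‖u y‖) ≤ 2 ^ N * (A * weight s (2 ^ s * h) 0 β) := by
          refine mul_le_mul (pow_le_pow_left₀ (by positivity) (by linarith) _)
            ((hu β y).trans (mul_le_mul_of_nonneg_left (weight_mono s hh hle _ _) hA))
            (by positivity) (by positivity)
      _ = 2 ^ N * A * 1 * weight s (2 ^ s * h) 0 β := by ring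
      _ ≤ _ := by gcongr; linarith
  · push Not at hy
    -- The sup norm of `y` is attained at some coordinate.
    obtain ⟨i, hi⟩ : ∃ i, ‖y‖ ≤ |y i| := by
      by_contra! hc
      exact lt_irrefl _ ((pi_norm_lt_iff (by linarith)).2 hc)
    have h3 := hu (β + Pi.single i N) y
    have h4 := weight_add_le hs hh 0 0 β (Pi.single i N)
    rw [add_zero] at h4
    rw [monomial_add, monomial_single, abs_mul, abs_pow] at h3
    calc (1 + ‖y‖) ^ N * (|monomial β y| * ‖u y‖)
        ≤ (2 * |y i|) ^ N * (|monomial β y| * ‖u y‖) := by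
          gcongr; linarith
      _ = 2 ^ N * (|monomial β y| * |y i| ^ N * ‖u y‖) := by ring
      _ ≤ 2 ^ N * (A * (weight s (2 ^ s * h) 0 β *
            weight s (2 ^ s * h) 0 (Pi.single i N))) := by
          exact mul_le_mul_of_nonneg_left (h3.trans (mul_le_mul_of_nonneg_left h4 hA))
            (by positivity)
      _ = 2 ^ N * A * weight s (2 ^ s * h) 0 (Pi.single i N) * weight s (2 ^ s * h) 0 β := by ring
      _ ≤ _ := by
          gcongr
          exact (Finset.single_le_sum hS0 (Finset.mem_univ i)).trans (by linarith)

theorem le_of_quot_le {s h : ℝ} (hh : 0 < h) {u : (Fin d → ℝ) → ℂ} {A : ℝ}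
    (hA : ∀ p, quot s h u p ≤ A) (α β : Fin d → ℕ) (x : Fin d → ℝ) :
    |monomial β x| * ‖multiD α u x‖ ≤ A * weight s h α β := by
  have := hA (α, β, x)
  rw [quot, div_le_iff₀ (weight_pos s hh _ _), norm_mul, Complex.norm_real] at this
  exact this

theorem bound_nonneg {s h : ℝ} (hh : 0 < h) {u : (Fin d → ℝ) → ℂ} {A : ℝ}
    (hA : ∀ p, quot s h u p ≤ A) : 0 ≤ A := (quot_nonneg s hh u (0, 0, 0)).trans (hA _)

theorem exists_bound {s : ℝ} {h : {h : ℝ // 0 < h}} {u : (Fin d → ℝ) → ℂ}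
    (hu : u ∈ stepSub d s h) : ∃ A, ∀ p, quot s h u p ≤ A := by
  obtain ⟨-, A, hA⟩ := hu
  exact ⟨A, fun p => hA ⟨p, rfl⟩⟩

theorem mem_stepSub_of_le {s : ℝ} {h : {h : ℝ // 0 < h}} {u : (Fin d → ℝ) → ℂ}
    (hu : ContDiff ℝ ∞ u) {A : ℝ} (hA : ∀ p, quot s h u p ≤ A) : u ∈ stepSub d s h :=
  ⟨hu, A, by rintro _ ⟨p, rfl⟩; exact hA p⟩

theorem partialD_mem_stepSub {s : ℝ} (hs : 0 ≤ s) {h k : {h : ℝ // 0 < h}}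
    (hk : 2 ^ s * (h : ℝ) = k) {u : (Fin d → ℝ) → ℂ} (hu : u ∈ stepSub d s h) (i : Fin d) :
    partialD i u ∈ stepSub d s k := by
  obtain ⟨A, hA⟩ := exists_bound hu
  refine mem_stepSub_of_le (A := A * weight s k (Pi.single i 1) 0) (contDiff_partialD hu.1 i) ?_
  rintro ⟨α, β, x⟩
  rw [quot, div_le_iff₀ (weight_pos s k.2 _ _), norm_mul, Complex.norm_real]
  simp only [multiD_partialD hu.1]
  refine (le_of_quot_le h.2 hA _ _ _).trans ?_
  rw [mul_assoc]
  refine mul_le_mul_of_nonneg_left ?_ (bound_nonneg h.2 hA)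
  have := weight_add_le hs h.2 α (Pi.single i 1) β 0
  rw [add_zero, hk] at this
  rwa [mul_comm]

theorem partialD_mem_gsSub {s : ℝ} (hs : 0 ≤ s) {u : (Fin d → ℝ) → ℂ} (hu : u ∈ gsSub d s)
    (i : Fin d) : partialD i u ∈ gsSub d s := by
  obtain ⟨h, hh⟩ := hu
  exact ⟨⟨2 ^ s * h, mul_pos (by positivity) h.2⟩, partialD_mem_stepSub hs rfl hh i⟩

theorem contDiff_of_mem_gsSub {s : ℝ} {u : (Fin d → ℝ) → ℂ} (hu : u ∈ gsSub d s) :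
    ContDiff ℝ ∞ u := by
  obtain ⟨h, hh⟩ := hu
  exact hh.1

theorem multiD_mem_gsSub {s : ℝ} (hs : 0 ≤ s) {u : (Fin d → ℝ) → ℂ} (hu : u ∈ gsSub d s)
    (α : Fin d → ℕ) : multiD α u ∈ gsSub d s := by
  induction α using multiIndex_induction with
  | h0 => rwa [multiD_zero]
  | h1 α i ih =>
    rw [← partialD_multiD (contDiff_of_mem_gsSub hu)]
    exact partialD_mem_gsSub hs ih i

/-- The basic estimate for convolutions: the factor `u` absorbs the growth, in `y`, of the
translates of `v`. -/
theorem exists_translate_bound {s : ℝ} (hs : 0 ≤ s) {h : {h : ℝ // 0 < h}}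
    {u v : (Fin d → ℝ) → ℂ} (hu : u ∈ stepSub d s h) (hv : v ∈ stepSub d s h) {k : ℝ}
    (hk : 2 * (2 ^ s * (h : ℝ)) ≤ k) (N : ℕ) :
    ∃ C, 0 ≤ C ∧ ∀ α β x y, (1 + ‖y‖) ^ N * (‖u y‖ * (|monomial β x| * ‖multiD α v (x - y)‖)) ≤
      C * weight s k α β := by
  obtain ⟨A, hA⟩ := exists_bound hu
  obtain ⟨B, hB⟩ := exists_bound hv
  have hu' : ∀ β y, |monomial β y| * ‖u y‖ ≤ A * weight s h 0 β := by
    intro β y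
    simpa [multiD_zero] using le_of_quot_le h.2 hA 0 β y
  obtain ⟨C, hC, hC'⟩ := one_add_norm_pow_mul_le hs h.2 hu' N
  have hB0 := bound_nonneg h.2 hB
  have h2 := one_le_two_rpow hs
  have hh := h.2
  have hle : (h : ℝ) ≤ 2 ^ s * h := le_mul_of_one_le_left h.2.le h2
  have hh' : (0 : ℝ) < 2 ^ s * h := by positivity
  refine ⟨C * B, by positivity, fun α β x y => ?_⟩
  obtain ⟨δ, γ, h1, h3, h4⟩ := exists_monomial_le β x y
  have h5 := hC' δ y
  have h6 := (le_of_quot_le h.2 hB α γ (x - y)).trans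
    (mul_le_mul_of_nonneg_left (weight_mono s h.2 hle α γ) hB0)
  have w1 := weight_pos s hh' 0 δ
  calc (1 + ‖y‖) ^ N * (‖u y‖ * (|monomial β x| * ‖multiD α v (x - y)‖))
      ≤ (1 + ‖y‖) ^ N * (‖u y‖ * (2 ^ (∑ i, β i) * (|monomial δ y| * |monomial γ (x - y)|) *
          ‖multiD α v (x - y)‖)) := by gcongr
    _ = 2 ^ (∑ i, β i) * (((1 + ‖y‖) ^ N * (|monomial δ y| * ‖u y‖)) *
          (|monomial γ (x - y)| * ‖multiD α v (x - y)‖)) := by ring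
    _ ≤ 2 ^ (∑ i, β i) * ((C * weight s (2 ^ s * h) 0 δ) * (B * weight s (2 ^ s * h) α γ)) := by
        gcongr
    _ = C * B * (2 ^ (∑ i, β i) * weight s (2 ^ s * h) α β) := by
        rw [← weight_mul_of_factorial s _ h1 h3]; ring
    _ ≤ C * B * weight s k α β := by
        refine mul_le_mul_of_nonneg_left ?_ (by positivity)
        exact (two_pow_mul_weight_le s hh' α β).trans (weight_mono s (by positivity) hk α β)

/-! ### Translations -/

/-- The translate `u(· - y)`. -/
def shift (y : Fin d → ℝ) (u : (Fin d → ℝ) → ℂ) : (Fin d → ℝ) → ℂ := fun x => u (x - y)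

theorem shift_zero (u : (Fin d → ℝ) → ℂ) : shift 0 u = u := by
  funext x; simp [shift]

theorem contDiff_shift (y : Fin d → ℝ) {u : (Fin d → ℝ) → ℂ} (hu : ContDiff ℝ ∞ u) :
    ContDiff ℝ ∞ (shift y u) := hu.comp (contDiff_id.sub contDiff_const)

theorem multiD_shift (y : Fin d → ℝ) {u : (Fin d → ℝ) → ℂ} (hu : ContDiff ℝ ∞ u)
    (α : Fin d → ℕ) : multiD α (shift y u) = shift y (multiD α u) := by
  have hT : IsDerivTower fun α => shift y (multiD α u) := by
    intro α x
    have h1 := (isDerivTower_multiD hu α (x - y)).comp x ((hasFDerivAt_id x).sub_const y)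
    refine h1.congr_fderiv ?_
    ext t
    simp [shift]
  simpa [multiD_zero] using hT.multiD_eq α

section Translate

variable {s : ℝ} {h k : {h : ℝ // 0 < h}} {u v w : (Fin d → ℝ) → ℂ}

/-- The `𝒮_{s,k}` norm of the translate of `v` by `y` is at most `C / |u(y)|`. -/
theorem exists_norm_mul_quot_shift_le (hs : 0 ≤ s) (hu : u ∈ stepSub d s h)
    (hv : v ∈ stepSub d s h) (hk : 2 * (2 ^ s * (h : ℝ)) ≤ k) (N : ℕ) :
    ∃ C, 0 ≤ C ∧ ∀ y p, (1 + ‖y‖) ^ N * (‖u y‖ * quot s k (shift y v) p) ≤ C := by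
  obtain ⟨C, hC, hC'⟩ := exists_translate_bound hs hu hv hk N
  refine ⟨C, hC, ?_⟩
  rintro y ⟨α, β, x⟩
  have h1 := hC' α β x y
  have hw := weight_pos s k.2 α β
  rw [quot, multiD_shift y hv.1, norm_mul, Complex.norm_real, ← mul_div_assoc, ← mul_div_assoc,
    div_le_iff₀ hw]
  exact h1

/-- A nowhere vanishing `w` in the same step as `v` controls the translates of `v`. It will be a
Gaussian. -/
theorem shift_mem (hs : 0 ≤ s) (hw : w ∈ stepSub d s h) (hw0 : ∀ y, w y ≠ 0)
    (hv : v ∈ stepSub d s h) (hk : 2 * (2 ^ s * (h : ℝ)) ≤ k) (y : Fin d → ℝ) :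
    shift y v ∈ stepSub d s k := by
  obtain ⟨C, hC, hC'⟩ := exists_norm_mul_quot_shift_le hs hw hv hk 0
  refine mem_stepSub_of_le (A := C / ‖w y‖) (contDiff_shift y hv.1) fun p => ?_
  rw [le_div_iff₀ (norm_pos_iff.2 (hw0 y)), mul_comm]
  simpa using hC' y p

/-- Translation is continuous as a map into `𝒮_{s,k}`, being locally Lipschitz there. -/
theorem continuous_emb_shift (hs : 0 ≤ s) (hw : w ∈ stepSub d s h) (hw0 : ∀ y, w y ≠ 0)
    (hv : v ∈ stepSub d s h) (hk : 2 * (2 ^ s * (2 ^ s * (h : ℝ))) ≤ k)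
    (hm : ∀ y, shift y v ∈ stepSub d s k) :
    Continuous fun y => Step.emb d s k (.of (hm y)) := by
  have h2 := one_le_two_rpow hs
  let h' : {h : ℝ // 0 < h} := ⟨2 ^ s * h, mul_pos (by positivity) h.2⟩
  have hle : h ≤ h' := le_mul_of_one_le_left h.2.le h2
  have hw' := stepSub_mono d s hle hw
  choose C hC hC' using fun i => exists_translate_bound (k := k) hs hw'
    (partialD_mem_stepSub (k := h') hs rfl hv i) hk 0
  rw [continuous_iff_continuousAt]
  intro y₀
  have hwc : Continuous fun y => ‖w y‖⁻¹ :=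
    hw.1.continuous.norm.inv₀ fun y => norm_ne_zero_iff.2 (hw0 y)
  obtain ⟨M, hM⟩ := (isCompact_closedBall y₀ (1 : ℝ)).bddAbove_image hwc.continuousOn
  have hM' : ∀ y ∈ Metric.closedBall y₀ (1 : ℝ), ‖w y‖⁻¹ ≤ M := fun y hy => hM ⟨y, hy, rfl⟩
  have hM0 : 0 ≤ M := (by positivity : (0:ℝ) ≤ ‖w y₀‖⁻¹).trans
    (hM' y₀ (Metric.mem_closedBall_self zero_le_one))
  set K : ℝ := ∑ i, M * C i
  have hK : 0 ≤ K := Finset.sum_nonneg fun i _ => mul_nonneg hM0 (hC i)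
  have key : ∀ y ∈ Metric.closedBall y₀ (1 : ℝ), ‖Step.emb d s k (.of (hm y)) -
      Step.emb d s k (.of (hm y₀))‖ ≤ K * ‖y - y₀‖ := by
    intro y hy
    refine lp.norm_le_of_forall_le (by positivity) ?_
    rintro ⟨α, β, x⟩
    change ‖coord s k (shift y v) (α, β, x) - coord s k (shift y₀ v) (α, β, x)‖ ≤ _
    set c : ℂ := (monomial β x : ℂ) / (weight s k α β : ℂ) with hc
    have hcoord : ∀ z, coord s k (shift z v) (α, β, x) = c * multiD α v (x - z) := by
      intro z
      rw [coord, multiD_shift z hv.1, hc, shift]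
      ring
    simp only [hcoord]
    have hd : ∀ z, HasFDerivAt (fun z => c * multiD α v (x - z))
        (gradCLM fun i => -(c * multiD (α + Pi.single i 1) v (x - z))) z := by
      intro z
      have h1 := (((isDerivTower_multiD hv.1 α (x - z)).comp z
        ((hasFDerivAt_id z).const_sub x)).const_mul c)
      refine h1.congr_fderiv ?_
      ext t
      simp [gradCLM_apply, Finset.mul_sum]
      refine Finset.sum_congr rfl fun i _ => by ring
    refine Convex.norm_image_sub_le_of_norm_hasFDerivWithin_le
      (s := Metric.closedBall y₀ (1 : ℝ)) (fun z _ => (hd z).hasFDerivWithinAt) ?_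
      (convex_closedBall _ _) (Metric.mem_closedBall_self zero_le_one) hy
    intro z hz
    refine (norm_gradCLM_le _).trans (Finset.sum_le_sum fun i _ => ?_)
    have h1 := hC' i α β x z
    rw [pow_zero, one_mul, multiD_partialD hv.1] at h1
    have hwz : 0 < ‖w z‖ := norm_pos_iff.2 (hw0 z)
    have hwt := weight_pos s k.2 α β
    rw [norm_neg, hc, norm_mul, norm_div, Complex.norm_real, Complex.norm_real,
      Real.norm_of_nonneg hwt.le, div_mul_eq_mul_div, div_le_iff₀ hwt]
    calc |monomial β x| * ‖multiD (α + Pi.single i 1) v (x - z)‖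
        = ‖w z‖⁻¹ * (‖w z‖ * (|monomial β x| * ‖multiD (α + Pi.single i 1) v (x - z)‖)) := by
          field_simp
      _ ≤ M * (C i * weight s k α β) := by
          refine mul_le_mul (hM' z hz) h1 (by positivity) hM0
      _ = _ := by ring
  rw [ContinuousAt, tendsto_iff_norm_sub_tendsto_zero]
  have h0 : Tendsto (fun y => K * ‖y - y₀‖) (𝓝 y₀) (𝓝 0) :=
    (by fun_prop : Continuous fun y => K * ‖y - y₀‖).tendsto' _ _ (by simp)
  refine squeeze_zero' (Eventually.of_forall fun _ => norm_nonneg _) ?_ h0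
  filter_upwards [Metric.closedBall_mem_nhds y₀ one_pos] with y hy using key y hy

theorem integrable_smul_emb_shift (hs : 0 ≤ s) (hw : w ∈ stepSub d s h) (hw0 : ∀ y, w y ≠ 0)
    (hu : u ∈ stepSub d s h) (hv : v ∈ stepSub d s h)
    (hk : 2 * (2 ^ s * (2 ^ s * (h : ℝ))) ≤ k) (hm : ∀ y, shift y v ∈ stepSub d s k) :
    Integrable fun y => u y • Step.emb d s k (.of (hm y)) := by
  obtain ⟨C, hC, hC'⟩ :=
    exists_norm_mul_quot_shift_le hs hu hv (two_mul_rpow_le hs hk) (d + 1)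
  refine Integrable.mono' (g := fun y => C * (1 + ‖y‖) ^ (-((d + 1 : ℕ) : ℝ))) ?_ ?_ ?_
  · exact (integrable_one_add_norm (by simp)).const_mul C
  · exact (hu.1.continuous.smul
      (continuous_emb_shift hs hw hw0 hv hk hm)).aestronglyMeasurable
  · refine Eventually.of_forall fun y => ?_
    have hy : (0 : ℝ) < 1 + ‖y‖ := by positivity
    rw [Real.rpow_neg hy.le, Real.rpow_natCast, ← div_eq_mul_inv, norm_smul,
      LinearIsometry.norm_map,
      le_div_iff₀ (by positivity), mul_comm]
    by_cases hy0 : u y = 0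
    · simpa [hy0] using hC
    have hun : 0 < ‖u y‖ := norm_pos_iff.2 hy0
    rw [← mul_assoc, ← le_div_iff₀' (by positivity)]
    refine Step.norm_le _ fun p => ?_
    rw [le_div_iff₀' (by positivity), mul_assoc]
    exact hC' y p

end Translate

/-! ### Convolutions -/

theorem integrable_mul_comp_sub {s : ℝ} (hs : 0 ≤ s) {u v : (Fin d → ℝ) → ℂ}
    (hu : u ∈ gsSub d s) (hv : v ∈ gsSub d s) (x : Fin d → ℝ) :
    Integrable fun y => u y * v (x - y) := by
  obtain ⟨h, hh⟩ := hu
  obtain ⟨h', hh'⟩ := hv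
  obtain ⟨C, hC, hC'⟩ := exists_translate_bound hs
    (stepSub_mono d s (le_max_left h h') hh) (stepSub_mono d s (le_max_right h h') hh')
    le_rfl (d + 1)
  refine Integrable.mono' (g := fun y => C * (1 + ‖y‖) ^ (-((d + 1 : ℕ) : ℝ))) ?_ ?_ ?_
  · exact (integrable_one_add_norm (by simp)).const_mul C
  · exact (hh.1.continuous.mul (hh'.1.continuous.comp
      (continuous_const.sub continuous_id))).aestronglyMeasurable
  · refine Eventually.of_forall fun y => ?_
    have hy : (0 : ℝ) < 1 + ‖y‖ := by positivity
    rw [Real.rpow_neg hy.le, Real.rpow_natCast, ← div_eq_mul_inv, norm_mul,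
      le_div_iff₀ (by positivity), mul_comm]
    simpa [multiD_zero, weight_zero, monomial_zero] using hC' 0 0 x y

/-- Integration by parts; the reflection `y ↦ x - y` cancels the sign. -/
theorem integral_mul_partialD {s : ℝ} (hs : 0 ≤ s) {u v : (Fin d → ℝ) → ℂ}
    (hu : u ∈ gsSub d s) (hv : v ∈ gsSub d s) (i : Fin d) (x : Fin d → ℝ) :
    ∫ y, u y * partialD i v (x - y) = ∫ y, partialD i u y * v (x - y) := by
  have cu := contDiff_of_mem_gsSub hu
  have cv := contDiff_of_mem_gsSub hv
  have hd : ∀ y, fderiv ℝ (fun y => v (x - y)) y (Pi.single i 1) = -partialD i v (x - y) := by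
    intro y
    have := ((cv.differentiable (by simp) (x - y)).hasFDerivAt.comp y
      ((hasFDerivAt_id y).const_sub x)).fderiv
    simp only [Function.comp_def] at this
    change _ = fderiv ℝ v (x - y) ∘SL (-ContinuousLinearMap.id ℝ (Fin d → ℝ)) at this
    simp [this, partialD]
  have key := integral_mul_fderiv_eq_neg_fderiv_mul_of_integrable (μ := volume) (f := u)
    (g := fun y => v (x - y)) (v := Pi.single i 1) ?_ ?_ ?_ ?_ ?_
  · simp only [hd, mul_neg, integral_neg, neg_inj] at key
    exact key
  · exact integrable_mul_comp_sub hs (partialD_mem_gsSub hs hu i) hv x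
  · simp only [hd, mul_neg]
    exact (integrable_mul_comp_sub hs hu (partialD_mem_gsSub hs hv i) x).neg
  · exact integrable_mul_comp_sub hs hu hv x
  · exact fun y _ => cu.differentiable (by simp) y
  · exact fun y _ => (cv.comp (contDiff_const.sub contDiff_id)).differentiable (by simp) y

theorem integral_mul_multiD {s : ℝ} (hs : 0 ≤ s) {u v : (Fin d → ℝ) → ℂ}
    (hu : u ∈ gsSub d s) (hv : v ∈ gsSub d s) (α : Fin d → ℕ) (x : Fin d → ℝ) :
    ∫ y, u y * multiD α v (x - y) = ∫ y, multiD α u y * v (x - y) := by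
  have cu := contDiff_of_mem_gsSub hu
  have cv := contDiff_of_mem_gsSub hv
  induction α using multiIndex_induction generalizing u with
  | h0 => simp only [multiD_zero]
  | h1 α i ih =>
    rw [← partialD_multiD cv, integral_mul_partialD hs hu (multiD_mem_gsSub hs hv α),
      ih (partialD_mem_gsSub hs hu i) (contDiff_partialD cu i), multiD_partialD cu]

/-- Commutativity of the convolution, as an identity between Bochner integrals of translates. -/
theorem integral_smul_emb_shift_comm {s : ℝ} {h k : {h : ℝ // 0 < h}} {u v w : (Fin d → ℝ) → ℂ}
    (hs : 0 ≤ s) (hw : w ∈ stepSub d s h) (hw0 : ∀ y, w y ≠ 0)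
    (hu : u ∈ stepSub d s h) (hv : v ∈ stepSub d s h)
    (hk : 2 * (2 ^ s * (2 ^ s * (h : ℝ))) ≤ k) (hmu : ∀ y, shift y u ∈ stepSub d s k)
    (hmv : ∀ y, shift y v ∈ stepSub d s k) :
    ∫ y, u y • Step.emb d s k (.of (hmv y)) = ∫ y, v y • Step.emb d s k (.of (hmu y)) := by
  ext p
  have hev : ∀ (a b : (Fin d → ℝ) → ℂ) (ha : a ∈ stepSub d s h) (hb : b ∈ stepSub d s h)
      (hm : ∀ y, shift y b ∈ stepSub d s k),
      (∫ y, a y • Step.emb d s k (.of (hm y)) : Ell d) p =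
        (monomial p.2.1 p.2.2 : ℂ) / (weight s k p.1 p.2.1 : ℂ) *
          ∫ y, a y * multiD p.1 b (p.2.2 - y) := by
    intro a b ha hb hm
    rw [← evalCLM_ell (𝕜 := ℂ), ← ContinuousLinearMap.integral_comp_comm _
      (integrable_smul_emb_shift hs hw hw0 ha hb hk hm), ← integral_const_mul]
    refine integral_congr_ae (Eventually.of_forall fun y => ?_)
    simp only [map_smul, evalCLM_ell, smul_eq_mul]
    change a y * coord s k (shift y b) p = _
    rw [coord, multiD_shift y hb.1, shift]
    ring
  rw [hev u v hu hv hmv, hev v u hv hu hmu, integral_mul_multiD hs ⟨h, hu⟩ ⟨h, hv⟩,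
    ← integral_sub_left_eq_self _ volume p.2.2]
  simp only [sub_sub_cancel, mul_comm]

/-! ### Gaussians -/

/-- The derivatives of `t ↦ exp (-b t²)`, given by the recurrence of the Hermite polynomials. -/
noncomputable def gaussDeriv (b : ℝ) : ℕ → ℝ → ℝ
  | 0 => fun t => Real.exp (-b * t ^ 2)
  | 1 => fun t => -(2 * b) * t * Real.exp (-b * t ^ 2)
  | n + 2 => fun t => -(2 * b) * t * gaussDeriv b (n + 1) t - 2 * b * (n + 1) * gaussDeriv b n t

theorem hasDerivAt_gaussDeriv (b : ℝ) (n : ℕ) (t : ℝ) :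
    HasDerivAt (gaussDeriv b n) (gaussDeriv b (n + 1) t) t := by
  induction n using Nat.strong_induction_on generalizing t with
  | _ n ih =>
    have h0 : HasDerivAt (gaussDeriv b 0) (gaussDeriv b 1 t) t := by
      change HasDerivAt (fun t => Real.exp (-b * t ^ 2)) (-(2 * b) * t * Real.exp (-b * t ^ 2)) t
      refine ((hasDerivAt_pow 2 t).const_mul (-b)).exp.congr_deriv ?_
      push_cast
      ring
    match n, ih with
    | 0, _ => exact h0
    | 1, _ =>
      change HasDerivAt (fun t => -(2 * b) * t * gaussDeriv b 0 t)
        (-(2 * b) * t * gaussDeriv b 1 t - 2 * b * ((0 : ℕ) + 1) * gaussDeriv b 0 t) t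
      refine (((hasDerivAt_id' t).const_mul (-(2 * b))).fun_mul h0).congr_deriv ?_
      push_cast
      ring
    | n + 2, ih =>
      have h1 := ih (n + 1) (by omega) t
      have h2 := ih n (by omega) t
      change HasDerivAt
        (fun t => -(2 * b) * t * gaussDeriv b (n + 1) t - 2 * b * (n + 1) * gaussDeriv b n t)
        (-(2 * b) * t * gaussDeriv b (n + 2) t -
          2 * b * ((n + 1 : ℕ) + 1) * gaussDeriv b (n + 1) t) t
      refine ((((hasDerivAt_id' t).const_mul (-(2 * b))).fun_mul h1).fun_sub
        (h2.const_mul (2 * b * ((n : ℝ) + 1)))).congr_deriv ?_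
      push_cast
      ring

theorem abs_pow_mul_gaussDeriv_zero_le {b K : ℝ} (hb : 0 < b) (hK : 0 ≤ K) (hbK : 1 ≤ 2 * b * K ^ 2)
    (m : ℕ) (t : ℝ) : |t| ^ m * |gaussDeriv b 0 t| ≤ K ^ m * √(m.factorial : ℝ) := by
  have h1 := Real.pow_div_factorial_le_exp (x := 2 * b * t ^ 2) (by positivity) m
  have hm : (0 : ℝ) < m.factorial := by exact_mod_cast m.factorial_pos
  rw [div_le_iff₀ hm] at h1
  have h2 : K ^ m * √(m.factorial : ℝ) = √((K ^ 2) ^ m * m.factorial) := by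
    rw [Real.sqrt_mul (by positivity), ← pow_mul, mul_comm 2 m, pow_mul,
      Real.sqrt_sq (by positivity)]
  rw [h2]
  refine Real.le_sqrt_of_sq_le ?_
  rw [gaussDeriv, abs_of_pos (Real.exp_pos _), mul_pow, ← Real.exp_nat_mul, ← pow_mul, mul_comm m 2,
    pow_mul, sq_abs]
  have h3 : (t ^ 2) ^ m ≤ (K ^ 2) ^ m * (2 * b * t ^ 2) ^ m := by
    rw [← mul_pow]
    refine pow_le_pow_left₀ (by positivity) ?_ _
    nlinarith [sq_nonneg t]
  calc (t ^ 2) ^ m * Real.exp (((2 : ℕ) : ℝ) * (-b * t ^ 2))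
      ≤ ((K ^ 2) ^ m * (Real.exp (2 * b * t ^ 2) * m.factorial)) *
        Real.exp (((2 : ℕ) : ℝ) * (-b * t ^ 2)) := by
        gcongr
        exact h3.trans (mul_le_mul_of_nonneg_left h1 (by positivity))
    _ = (K ^ 2) ^ m * m.factorial *
        (Real.exp (2 * b * t ^ 2) * Real.exp (((2 : ℕ) : ℝ) * (-b * t ^ 2))) := by ring
    _ = (K ^ 2) ^ m * m.factorial := by
        rw [← Real.exp_add]
        have : 2 * b * t ^ 2 + ((2 : ℕ) : ℝ) * (-b * t ^ 2) = 0 := by push_cast; ring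
        rw [this, Real.exp_zero, mul_one]

/-- The bound is by `√(n + m)!` rather than `√(n! m!)`, so that the induction closes: the first term
of the recurrence trades a derivative for a power of `t`, which would cost the unbounded factor
`√((m + 1) / (n + 1))`. -/
theorem abs_pow_mul_gaussDeriv_le {b K H : ℝ} (hb : 0 < b) (hK : 0 ≤ K) (hbK : 1 ≤ 2 * b * K ^ 2)
    (hH : 2 * b * K + 2 * b + 1 ≤ H) (n m : ℕ) (t : ℝ) :
    |t| ^ m * |gaussDeriv b n t| ≤ H ^ n * K ^ m * √((n + m).factorial : ℝ) := by
  have hbK0 : 0 ≤ b * K := by positivity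
  have hH0 : 0 ≤ H := by nlinarith
  induction n using Nat.strong_induction_on generalizing m with
  | _ n ih =>
    match n, ih with
    | 0, _ => simpa using abs_pow_mul_gaussDeriv_zero_le hb hK hbK m t
    | 1, ih =>
      have h0 := ih 0 one_pos (m + 1)
      have h1 : gaussDeriv b 1 t = -(2 * b) * t * gaussDeriv b 0 t := rfl
      rw [h1, abs_mul, abs_mul, abs_neg, abs_of_pos (by positivity : 0 < 2 * b)]
      rw [pow_zero, one_mul, zero_add] at h0
      rw [pow_one, add_comm 1 m]
      calc |t| ^ m * (2 * b * |t| * |gaussDeriv b 0 t|)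
          = 2 * b * (|t| ^ (m + 1) * |gaussDeriv b 0 t|) := by ring
        _ ≤ 2 * b * (K ^ (m + 1) * √((m + 1).factorial : ℝ)) := by gcongr
        _ = (2 * b * K) * K ^ m * √((m + 1).factorial : ℝ) := by ring
        _ ≤ H * K ^ m * √((m + 1).factorial : ℝ) := by
            gcongr; linarith
    | n + 2, ih =>
      have h1 := ih (n + 1) (by omega) (m + 1)
      have h2 := ih n (by omega) m
      have e : gaussDeriv b (n + 2) t =
        -(2 * b) * t * gaussDeriv b (n + 1) t - 2 * b * (n + 1) * gaussDeriv b n t := rfl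
      have hfac : ((n : ℝ) + 1) * √((n + m).factorial : ℝ) ≤ √((n + 2 + m).factorial : ℝ) := by
        refine Real.le_sqrt_of_sq_le ?_
        rw [mul_pow, Real.sq_sqrt (Nat.cast_nonneg _)]
        have : n + 2 + m = (n + m + 1) + 1 := by ring
        rw [this, Nat.factorial_succ, Nat.factorial_succ]
        have : (n + 1) ^ 2 * (n + m).factorial ≤
            (n + m + 1 + 1) * ((n + m + 1) * (n + m).factorial) := by
          rw [← mul_assoc]
          refine Nat.mul_le_mul_right _ ?_
          nlinarith
        exact_mod_cast this
      have hs : n + 1 + (m + 1) = n + 2 + m := by ring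
      rw [hs] at h1
      have hn : (0 : ℝ) ≤ n + 1 := by positivity
      calc |t| ^ m * |gaussDeriv b (n + 2) t|
          ≤ |t| ^ m * (|-(2 * b) * t * gaussDeriv b (n + 1) t| +
              |2 * b * (n + 1) * gaussDeriv b n t|) := by
            rw [e]; gcongr; exact abs_sub _ _
        _ = 2 * b * (|t| ^ (m + 1) * |gaussDeriv b (n + 1) t|) +
              2 * b * (n + 1) * (|t| ^ m * |gaussDeriv b n t|) := by
            simp only [abs_mul, abs_neg, abs_of_pos hb, abs_two, abs_of_nonneg hn]; ring
        _ ≤ 2 * b * (H ^ (n + 1) * K ^ (m + 1) * √((n + 2 + m).factorial : ℝ)) +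
              2 * b * (n + 1) * (H ^ n * K ^ m * √((n + m).factorial : ℝ)) := by gcongr
        _ = H ^ n * K ^ m * (2 * b * K * H * √((n + 2 + m).factorial : ℝ) +
              2 * b * ((n + 1) * √((n + m).factorial : ℝ))) := by ring
        _ ≤ H ^ n * K ^ m * (2 * b * K * H * √((n + 2 + m).factorial : ℝ) +
              2 * b * √((n + 2 + m).factorial : ℝ)) := by gcongr
        _ = H ^ n * K ^ m * √((n + 2 + m).factorial : ℝ) * (2 * b * K * H + 2 * b) := by ring
        _ ≤ H ^ n * K ^ m * √((n + 2 + m).factorial : ℝ) * (H ^ 2) := by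
            gcongr; nlinarith
        _ = _ := by ring

theorem exists_gaussDeriv_bound {b : ℝ} (hb : 0 < b) : ∃ L : ℝ, 0 < L ∧ ∀ (n m : ℕ) (t : ℝ),
    |t| ^ m * |gaussDeriv b n t| ≤ L ^ (n + m) * √((n.factorial * m.factorial : ℕ) : ℝ) := by
  set K : ℝ := 1 + 1 / (2 * b) with hK
  have hK0 : 0 ≤ K := by positivity
  have hbK : 1 ≤ 2 * b * K ^ 2 := by
    have : 2 * b * K ^ 2 = 2 * b + 2 + 1 / (2 * b) := by
      rw [hK]; field_simp; ring
    rw [this]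
    have : 0 ≤ 1 / (2 * b) := by positivity
    linarith
  set H : ℝ := 2 * b * K + 2 * b + 1 with hH
  have hH0 : 0 ≤ H := by positivity
  refine ⟨2 * (H + K), by positivity, fun n m t => ?_⟩
  refine (abs_pow_mul_gaussDeriv_le hb hK0 hbK hH.ge n m t).trans ?_
  have h1 : √((n + m).factorial : ℝ) ≤ 2 ^ (n + m) * √((n.factorial * m.factorial : ℕ) : ℝ) := by
    rw [← Nat.add_choose_mul_factorial_mul_factorial, mul_assoc, Nat.cast_mul,
      Real.sqrt_mul (Nat.cast_nonneg _)]
    gcongr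
    refine Real.sqrt_le_iff.2 ⟨by positivity, ?_⟩
    have h2 : ((Nat.choose (n + m) m : ℕ) : ℝ) ≤ 2 ^ (n + m) := by
      exact_mod_cast Nat.choose_le_two_pow _ _
    exact h2.trans (le_self_pow₀ (one_le_pow₀ (by norm_num)) two_ne_zero)
  calc H ^ n * K ^ m * √((n + m).factorial : ℝ)
      ≤ (H + K) ^ n * (H + K) ^ m * (2 ^ (n + m) * √((n.factorial * m.factorial : ℕ) : ℝ)) := by
        gcongr <;> linarith
    _ = _ := by rw [mul_pow, pow_add (H + K)]; ring

/-- The partial derivatives of the Gaussian `exp (-b |x|²)`. -/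
noncomputable def gaussTower (d : ℕ) (b : ℝ) (α : Fin d → ℕ) (x : Fin d → ℝ) : ℂ :=
  ∏ i, ((gaussDeriv b (α i) (x i) : ℝ) : ℂ)

/-- The Gaussian `exp (-b |x|²)`, with `|x|` the Euclidean length. -/
noncomputable def gauss (d : ℕ) (b : ℝ) (x : Fin d → ℝ) : ℂ :=
  ((∏ i, Real.exp (-b * x i ^ 2) : ℝ) : ℂ)

theorem gaussTower_zero (b : ℝ) : gaussTower d b 0 = gauss d b := by
  funext x
  simp [gaussTower, gauss, gaussDeriv]

theorem isDerivTower_gaussTower (b : ℝ) : IsDerivTower (gaussTower d b) := by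
  intro α x
  have h1 : ∀ i ∈ Finset.univ, HasFDerivAt
      (fun x : Fin d → ℝ => ((gaussDeriv b (α i) (x i) : ℝ) : ℂ))
      ((ContinuousLinearMap.proj (R := ℝ) (φ := fun _ : Fin d => ℝ) i).smulRight
        ((gaussDeriv b (α i + 1) (x i) : ℝ) : ℂ)) x := by
    intro i _
    have h2 := (hasDerivAt_gaussDeriv b (α i) (x i)).ofReal_comp.hasFDerivAt.comp x
      (ContinuousLinearMap.proj (R := ℝ) (φ := fun _ : Fin d => ℝ) i).hasFDerivAt
    refine h2.congr_fderiv ?_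
    ext v
    simp
  have h3 := HasFDerivAt.finsetProd h1
  refine h3.congr_fderiv ?_
  ext v
  rw [gradCLM_apply]
  simp only [sum_apply, smul_apply, ContinuousLinearMap.smulRight_apply,
    ContinuousLinearMap.proj_apply]
  refine Finset.sum_congr rfl fun i _ => ?_
  rw [smul_comm]
  congr 1
  rw [gaussTower, ← Finset.mul_prod_erase _ _ (Finset.mem_univ i), smul_eq_mul, mul_comm]
  congr 1
  · simp
  · refine Finset.prod_congr rfl fun j hj => ?_
    simp [Finset.ne_of_mem_erase hj]

theorem exists_quot_gauss_le (d : ℕ) {b : ℝ} (hb : 0 < b) :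
    ∃ L : ℝ, 0 < L ∧ ∀ p, quot (1 / 2) L (gauss d b) p ≤ 1 := by
  obtain ⟨L, hL, hL'⟩ := exists_gaussDeriv_bound hb
  refine ⟨L, hL, ?_⟩
  rintro ⟨α, β, x⟩
  rw [quot, div_le_one (weight_pos _ hL _ _), ← gaussTower_zero,
    (isDerivTower_gaussTower b).multiD_eq, norm_mul, Complex.norm_real, monomial, gaussTower,
    norm_prod, norm_prod, ← Finset.prod_mul_distrib]
  have hw : weight (1 / 2) L α β =
      ∏ i, L ^ (α i + β i) * √(((α i).factorial * (β i).factorial : ℕ) : ℝ) := by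
    rw [weight, Finset.prod_mul_distrib, Finset.prod_pow_eq_pow_sum, Finset.sum_add_distrib]
    congr 1
    simp only [Real.sqrt_eq_rpow]
    rw [Real.finsetProd_rpow _ _ fun _ _ => Nat.cast_nonneg _, ← Nat.cast_prod,
      Finset.prod_mul_distrib]
  rw [hw]
  refine Finset.prod_le_prod (fun i _ => by positivity) fun i _ => ?_
  rw [norm_pow, Real.norm_eq_abs, Complex.norm_real, Real.norm_eq_abs]
  exact hL' _ _ _

theorem contDiff_gauss (d : ℕ) (b : ℝ) : ContDiff ℝ ∞ (gauss d b) := by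
  rw [← gaussTower_zero]
  exact (isDerivTower_gaussTower b).contDiff 0

theorem one_le_factorials (α β : Fin d → ℕ) :
    (1 : ℝ) ≤ (((∏ i, (α i).factorial) * ∏ i, (β i).factorial : ℕ) : ℝ) := by
  exact_mod_cast Nat.mul_pos (Finset.prod_pos fun i _ => Nat.factorial_pos _)
      (Finset.prod_pos fun i _ => Nat.factorial_pos _)

theorem weight_mono_exponent {s s' : ℝ} (hs : s ≤ s') {h : ℝ} (hh : 0 < h) (α β : Fin d → ℕ) :
    weight s h α β ≤ weight s' h α β :=
  mul_le_mul_of_nonneg_left (Real.rpow_le_rpow_of_exponent_le (one_le_factorials α β) hs)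
    (by positivity)

theorem gauss_mem_gsSub {s : ℝ} (hs : 1 / 2 ≤ s) {b : ℝ} (hb : 0 < b) :
    gauss d b ∈ gsSub d s := by
  obtain ⟨L, hL, hL'⟩ := exists_quot_gauss_le d hb
  refine ⟨⟨L, hL⟩, mem_stepSub_of_le (A := 1) (contDiff_gauss d b) fun p => ?_⟩
  exact (div_le_div_of_nonneg_left (norm_nonneg _) (weight_pos _ hL _ _)
    (weight_mono_exponent hs hL _ _)).trans (hL' p)

/-- Powers of factorials dominate geometric sequences; this is where `s > 1/2` is used in the
projective limit case. -/
theorem exists_pow_le_factorial_rpow {c r : ℝ} (hc : 0 < c) (hr : 0 < r) :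
    ∃ C : ℝ, 0 < C ∧ ∀ n : ℕ, c ^ n ≤ C * (n.factorial : ℝ) ^ r := by
  refine ⟨Real.exp (c ^ (1 / r)) ^ r, by positivity, fun n => ?_⟩
  have hn : (0 : ℝ) < n.factorial := by exact_mod_cast n.factorial_pos
  have h1 := Real.pow_div_factorial_le_exp (x := c ^ (1 / r)) (by positivity) n
  rw [div_le_iff₀ hn] at h1
  have h2 := Real.rpow_le_rpow (by positivity) h1 hr.le
  rw [Real.mul_rpow (by positivity) hn.le, ← Real.rpow_natCast (c ^ (1 / r)), ← Real.rpow_mul hc.le,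
    ← Real.rpow_mul hc.le] at h2
  rwa [show 1 / r * n * r = n by field_simp, Real.rpow_natCast] at h2

theorem exists_weight_le_weight {s s' : ℝ} (hs : s < s') {h k : ℝ} (hh : 0 < h) (hk : 0 < k) :
    ∃ C : ℝ, 0 < C ∧ ∀ α β : Fin d → ℕ, weight s h α β ≤ C * weight s' k α β := by
  obtain ⟨C, hC, hC'⟩ := exists_pow_le_factorial_rpow (div_pos hh hk) (sub_pos.2 hs)
  refine ⟨C ^ d * C ^ d, by positivity, fun α β => ?_⟩
  have key : ∀ α : Fin d → ℕ, (h / k) ^ (∑ i, α i) ≤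
      C ^ d * ((∏ i, (α i).factorial : ℕ) : ℝ) ^ (s' - s) := by
    intro α
    rw [← Finset.prod_pow_eq_pow_sum, Nat.cast_prod,
      ← Real.finsetProd_rpow _ _ fun _ _ => Nat.cast_nonneg _]
    calc ∏ i, (h / k) ^ α i ≤ ∏ i, C * ((α i).factorial : ℝ) ^ (s' - s) :=
          Finset.prod_le_prod (fun i _ => by positivity) fun i _ => hC' _
      _ = _ := by rw [Finset.prod_mul_distrib]; simp
  have hf := one_le_factorials α β
  set f : ℝ := (((∏ i, (α i).factorial) * ∏ i, (β i).factorial : ℕ) : ℝ) with hf'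
  have h1 : (h / k) ^ ((∑ i, α i) + ∑ i, β i) ≤ C ^ d * C ^ d * f ^ (s' - s) := by
    rw [pow_add, hf', Nat.cast_mul, Real.mul_rpow (Nat.cast_nonneg _) (Nat.cast_nonneg _),
      mul_mul_mul_comm]
    exact mul_le_mul (key α) (key β) (by positivity) (by positivity)
  have h2 : f ^ s' = f ^ (s' - s) * f ^ s := by
    rw [← Real.rpow_add (by linarith), sub_add_cancel]
  rw [weight, weight, ← hf', h2]
  rw [div_pow, div_le_iff₀ (by positivity)] at h1
  calc h ^ ((∑ i, α i) + ∑ i, β i) * f ^ s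
      ≤ (C ^ d * C ^ d * f ^ (s' - s) * k ^ ((∑ i, α i) + ∑ i, β i)) * f ^ s := by gcongr
    _ = _ := by ring

theorem gauss_mem_sigSub {s : ℝ} (hs : 1 / 2 < s) {b : ℝ} (hb : 0 < b) :
    gauss d b ∈ sigSub d s := by
  obtain ⟨L, hL, hL'⟩ := exists_quot_gauss_le d hb
  refine (Submodule.mem_iInf _).2 fun h => ?_
  obtain ⟨C, hC, hC'⟩ := exists_weight_le_weight (d := d) hs hL h.2
  refine mem_stepSub_of_le (A := C) (contDiff_gauss d b) fun p => ?_
  have h1 := hL' p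
  have h2 := hC' p.1 p.2.1
  rw [quot, div_le_one (weight_pos _ hL _ _)] at h1
  rw [quot, div_le_iff₀ (weight_pos _ h.2 _ _)]
  exact h1.trans h2

theorem gauss_ne_zero (b : ℝ) (x : Fin d → ℝ) : gauss d b x ≠ 0 := by
  rw [gauss, Complex.ofReal_ne_zero]
  exact (Finset.prod_pos fun i _ => Real.exp_pos _).ne'

/-- Translates of Gaussians are tensor products. -/
theorem shift_gauss_add (b : ℝ) (y : Fin (d₁ + d₂) → ℝ) :
    shift y (gauss (d₁ + d₂) b) = tensorFun
      (shift (fun i => y (Fin.castAdd d₂ i)) (gauss d₁ b))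
      (shift (fun j => y (Fin.natAdd d₁ j)) (gauss d₂ b)) := by
  funext x
  simp [shift, tensorFun, gauss, Fin.prod_univ_add]

/-- Gaussian means at vanishing width recover the value at the origin. -/
theorem eq_zero_of_integral_gauss_mul_eq_zero {F : (Fin d → ℝ) → ℂ} (hF : Continuous F) {C : ℝ}
    (hC : ∀ y, ‖gauss d 1 y‖ * ‖F y‖ ≤ C)
    (h0 : ∀ b : ℝ, 0 < b → ∫ y, gauss d b y * F y = 0) : F 0 = 0 := by
  have hnorm : ∀ b y, ‖gauss d b y‖ = ∏ i, Real.exp (-b * y i ^ 2) := by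
    intro b y
    rw [gauss, Complex.norm_real,
      Real.norm_of_nonneg (Finset.prod_nonneg fun _ _ => (Real.exp_pos _).le)]
  have hscale : ∀ δ : ℝ, 0 < δ → ∫ z, gauss d 1 z * F (δ • z) = 0 := by
    intro δ hδ
    have h1 := Measure.integral_comp_smul (volume : Measure (Fin d → ℝ))
      (fun y => gauss d (1 / δ ^ 2) y * F y) δ
    rw [h0 _ (by positivity), smul_zero] at h1
    rw [← h1]
    refine integral_congr_ae (Eventually.of_forall fun z => ?_)
    have : gauss d (1 / δ ^ 2) (δ • z) = gauss d 1 z := by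
      unfold gauss
      congr 1
      refine Finset.prod_congr rfl fun i _ => ?_
      congr 1
      simp only [Pi.smul_apply, smul_eq_mul]
      field_simp
    simp only [this]
  have hlim : Tendsto (fun δ : ℝ => ∫ z, gauss d 1 z * F (δ • z)) (𝓝[>] 0)
      (𝓝 (∫ z, gauss d 1 z * F 0)) := by
    refine tendsto_integral_filter_of_dominated_convergence
      (fun z => C * ∏ i, Real.exp (-(1 / 2) * z i ^ 2)) ?_ ?_ ?_ ?_
    · refine Eventually.of_forall fun δ => Continuous.aestronglyMeasurable ?_
      exact (contDiff_gauss d 1).continuous.mul (hF.comp (continuous_const_smul δ))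
    · have h2 : ∀ᶠ δ : ℝ in 𝓝[>] 0, δ < 1 / 2 :=
        nhdsWithin_le_nhds (gt_mem_nhds (by norm_num))
      filter_upwards [h2, self_mem_nhdsWithin] with δ hδ hδ0
      refine Eventually.of_forall fun z => ?_
      have hδ0' : (0 : ℝ) < δ := hδ0
      have h3 := hC (δ • z)
      have h4 : ‖gauss d 1 z‖ ≤ ‖gauss d 1 (δ • z)‖ * ∏ i, Real.exp (-(1 / 2) * z i ^ 2) := by
        rw [hnorm, hnorm, ← Finset.prod_mul_distrib]
        refine Finset.prod_le_prod (fun i _ => (Real.exp_pos _).le) fun i _ => ?_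
        rw [← Real.exp_add]
        refine Real.exp_le_exp.2 ?_
        simp only [Pi.smul_apply, smul_eq_mul]
        have h5 : δ ^ 2 ≤ 1 / 2 := by nlinarith
        nlinarith [sq_nonneg (z i)]
      rw [norm_mul]
      calc ‖gauss d 1 z‖ * ‖F (δ • z)‖
          ≤ ‖gauss d 1 (δ • z)‖ * (∏ i, Real.exp (-(1 / 2) * z i ^ 2)) * ‖F (δ • z)‖ := by gcongr
        _ = (‖gauss d 1 (δ • z)‖ * ‖F (δ • z)‖) * ∏ i, Real.exp (-(1 / 2) * z i ^ 2) := by ring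
        _ ≤ _ := mul_le_mul_of_nonneg_right h3 (Finset.prod_nonneg fun _ _ => (Real.exp_pos _).le)
    · exact (Integrable.fintype_prod (μ := fun _ : Fin d => (volume : Measure ℝ))
        (f := fun _ t => Real.exp (-(1 / 2) * t ^ 2))
        fun _ => integrable_exp_neg_mul_sq (by norm_num)).const_mul C
    · refine Eventually.of_forall fun z => ?_
      have h2 : Tendsto (fun δ : ℝ => δ • z) (𝓝[>] 0) (𝓝 0) :=
        ((continuous_id.smul continuous_const).tendsto' (0 : ℝ) _ (by simp)).mono_left
          nhdsWithin_le_nhds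
      exact ((hF.tendsto 0).comp h2).const_mul _
  have h1 : ∫ z, gauss d 1 z * F 0 = 0 := by
    refine tendsto_nhds_unique hlim (tendsto_const_nhds.congr' ?_)
    filter_upwards [self_mem_nhdsWithin] with δ hδ using (hscale δ hδ).symm
  rw [integral_mul_const] at h1
  refine (mul_eq_zero.1 h1).resolve_left ?_
  have h2 : ∫ z : Fin d → ℝ, ∏ i, Real.exp (-1 * z i ^ 2) ≠ 0 := by
    rw [integral_fintype_prod_volume_eq_pow fun t : ℝ => Real.exp (-1 * t ^ 2), integral_gaussian]
    have := Real.pi_pos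
    positivity
  unfold gauss
  rw [integral_complex_ofReal]
  exact Complex.ofReal_ne_zero.2 h2

/-! ### Functionals vanishing on translates of Gaussians -/

/-- Let `F y = ⟨f, φ(· - y)⟩`, where `f` vanishes on the translates of all Gaussians. Convolving
with a Gaussian in either order gives `∫ gauss b y * F y = 0`, and `b → ∞` gives `F 0 = 0`. The
steps `h, k` and the extension `Λ` of `f` may depend on `b`; they have to when `s = 1/2`, because
narrow Gaussians lie in `𝒮_{1/2,h}` for large `h` only. -/
theorem eq_zero_of_gauss {s : ℝ} (hs : 0 ≤ s) {φ F : (Fin d → ℝ) → ℂ}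
    (H : ∀ b : ℝ, 0 < b → ∃ (h k : {h : ℝ // 0 < h}) (Λ : Ell d →L[ℂ] ℂ),
      2 * (2 ^ s * (2 ^ s * (h : ℝ))) ≤ k ∧ φ ∈ stepSub d s h ∧ gauss d 1 ∈ stepSub d s h ∧
      gauss d b ∈ stepSub d s h ∧
      (∀ y (hy : shift y φ ∈ stepSub d s k), F y = Λ (Step.emb d s k (.of hy))) ∧
      (∀ y (hy : shift y (gauss d b) ∈ stepSub d s k), Λ (Step.emb d s k (.of hy)) = 0)) :
    F 0 = 0 := by
  obtain ⟨h, k, Λ, hk, hφ, hw, -, hF, -⟩ := H 1 one_pos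
  have hm := shift_mem hs hw (gauss_ne_zero 1) hφ (two_mul_rpow_le hs hk)
  have hF' : F = fun y => Λ (Step.emb d s k (.of (hm y))) := funext fun y => hF y (hm y)
  have hcont : Continuous F := by
    rw [hF']
    exact Λ.continuous.comp (continuous_emb_shift hs hw (gauss_ne_zero 1) hφ hk hm)
  obtain ⟨C, hC, hC'⟩ := exists_norm_mul_quot_shift_le hs hw hφ (two_mul_rpow_le hs hk) 0
  refine eq_zero_of_integral_gauss_mul_eq_zero hcont (C := ‖Λ‖ * C) (fun y => ?_) ?_
  · have hwy : 0 < ‖gauss d 1 y‖ := norm_pos_iff.2 (gauss_ne_zero 1 y)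
    have h3 : ‖Step.of (hm y)‖ ≤ C / ‖gauss d 1 y‖ := Step.norm_le _ fun p => by
      rw [le_div_iff₀' hwy]
      have h3 := hC' y p
      rw [pow_zero, one_mul] at h3
      exact h3
    rw [le_div_iff₀' hwy] at h3
    have h4 : ‖F y‖ ≤ ‖Λ‖ * ‖Step.of (hm y)‖ := by
      rw [hF']
      simpa only [LinearIsometry.norm_map] using Λ.le_opNorm (Step.emb d s k (.of (hm y)))
    calc ‖gauss d 1 y‖ * ‖F y‖ ≤ ‖gauss d 1 y‖ * (‖Λ‖ * ‖Step.of (hm y)‖) := by gcongr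
      _ = ‖Λ‖ * (‖gauss d 1 y‖ * ‖Step.of (hm y)‖) := by ring
      _ ≤ ‖Λ‖ * C := by gcongr
  · intro b hb
    obtain ⟨h, k, Λ, hk, hφ, hw, hg, hF, hΛ⟩ := H b hb
    have hm := shift_mem hs hw (gauss_ne_zero 1) hφ (two_mul_rpow_le hs hk)
    have hmg := shift_mem hs hw (gauss_ne_zero 1) hg (two_mul_rpow_le hs hk)
    have h3 := congrArg Λ
      (integral_smul_emb_shift_comm hs hw (gauss_ne_zero 1) hg hφ hk hmg hm)
    rw [← ContinuousLinearMap.integral_comp_comm _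
        (integrable_smul_emb_shift hs hw (gauss_ne_zero 1) hg hφ hk hm),
      ← ContinuousLinearMap.integral_comp_comm _
        (integrable_smul_emb_shift hs hw (gauss_ne_zero 1) hφ hg hk hmg)] at h3
    simp only [map_smul, hΛ, ← hF, smul_eq_mul, mul_zero, integral_zero] at h3
    exact h3

/-! ### Permutations of the coordinates -/

/-- The function `x ↦ φ (x ∘ σ)`. -/
def permFun (σ : Fin d ≃ Fin d') (φ : (Fin d → ℝ) → ℂ) : (Fin d' → ℝ) → ℂ := fun x => φ (x ∘ σ)

theorem isDerivTower_permFun (σ : Fin d ≃ Fin d') {φ : (Fin d → ℝ) → ℂ} (hφ : ContDiff ℝ ∞ φ) :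
    IsDerivTower fun α => permFun σ (multiD (α ∘ σ) φ) := by
  intro α x
  have h1 := (isDerivTower_multiD hφ (α ∘ σ) (x ∘ σ)).comp x (reidx σ).hasFDerivAt
  refine h1.congr_fderiv ?_
  ext v
  rw [ContinuousLinearMap.comp_apply, gradCLM_apply, gradCLM_apply, ← Equiv.sum_comp σ]
  refine Finset.sum_congr rfl fun j _ => ?_
  have h2 : (α + Pi.single (σ j) 1) ∘ σ = α ∘ σ + Pi.single j 1 := by
    funext l
    simp [Pi.single_apply]
  simp only [permFun, h2]
  rfl

theorem quot_permFun (σ : Fin d ≃ Fin d') (s h : ℝ) {φ : (Fin d → ℝ) → ℂ} (hφ : ContDiff ℝ ∞ φ)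
    (p) : quot s h (permFun σ φ) p = quot s h φ (p.1 ∘ σ, p.2.1 ∘ σ, p.2.2 ∘ σ) := by
  have h1 := (isDerivTower_permFun σ hφ).multiD_eq p.1
  have h0 : permFun σ (multiD ((0 : Fin d' → ℕ) ∘ σ) φ) = permFun σ φ := by
    congr 1
    exact multiD_zero φ
  rw [h0] at h1
  have hw : weight s h (p.1 ∘ σ) (p.2.1 ∘ σ) = weight s h p.1 p.2.1 := by
    unfold weight
    simp only [Function.comp_apply]
    rw [Equiv.sum_comp σ p.1, Equiv.sum_comp σ p.2.1,
      Equiv.prod_comp σ fun i => (p.1 i).factorial, Equiv.prod_comp σ fun i => (p.2.1 i).factorial]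
  have hm : monomial (p.2.1 ∘ σ) (p.2.2 ∘ σ) = monomial p.2.1 p.2.2 := by
    unfold monomial
    simp only [Function.comp_apply]
    rw [Equiv.prod_comp σ fun i => p.2.2 i ^ p.2.1 i]
  simp only [quot, h1, hw, hm, permFun]

theorem permFun_mem (σ : Fin d ≃ Fin d') {s : ℝ} {h : {h : ℝ // 0 < h}} {φ : (Fin d → ℝ) → ℂ}
    (hφ : φ ∈ stepSub d s h) : permFun σ φ ∈ stepSub d' s h := by
  obtain ⟨A, hA⟩ := exists_bound hφ
  refine mem_stepSub_of_le (A := A) (hφ.1.comp (reidx σ).contDiff) fun p => ?_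
  rw [quot_permFun σ s h hφ.1]
  exact hA _

/-- A linear map is continuous if its norm is controlled by that of a continuous linear map. -/
theorem continuous_of_norm_le {V F G : Type*} [AddCommGroup V] [Module ℂ V] [TopologicalSpace V]
    [NormedAddCommGroup F] [NormedSpace ℂ F] [NormedAddCommGroup G] [NormedSpace ℂ G]
    (T : V →ₗ[ℂ] F) (S : V →ₗ[ℂ] G) (hS : Continuous S) (C : ℝ) (hT : ∀ v, ‖T v‖ ≤ C * ‖S v‖) :
    Continuous T := by
  rw [continuous_iff_continuousAt]
  intro v
  rw [ContinuousAt, tendsto_iff_norm_sub_tendsto_zero]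
  have h0 : Tendsto (fun w => C * ‖S w - S v‖) (𝓝 v) (𝓝 0) :=
    (by fun_prop : Continuous fun w => C * ‖S w - S v‖).tendsto' _ _ (by simp)
  refine squeeze_zero (fun _ => norm_nonneg _) (fun w => ?_) h0
  rw [← map_sub, ← map_sub]
  exact hT _

/-- `φ ↦ φ (· ∘ σ)` on `𝒮_{s,h}`. -/
def Step.perm (σ : Fin d ≃ Fin d') (s : ℝ) (h : {h : ℝ // 0 < h}) :
    Step d s h →ₗ[ℂ] Step d' s h where
  toFun φ := .of (permFun_mem σ φ.2)
  map_add' _ _ := rfl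
  map_smul' _ _ := rfl

theorem Step.continuous_perm (σ : Fin d ≃ Fin d') (s : ℝ) (h : {h : ℝ // 0 < h}) :
    Continuous (Step.perm σ s h) := by
  refine continuous_of_norm_le _ LinearMap.id continuous_id 1 fun φ => ?_
  rw [one_mul]
  refine Step.norm_le _ fun p => ?_
  exact (quot_permFun σ s h φ.2.1 p).le.trans (Step.quot_le_norm φ _)

/-- `φ ↦ φ (· ∘ σ)` on `𝒮_s`. -/
def GS.perm (σ : Fin d ≃ Fin d') (s : ℝ) : GS d s →L[ℂ] GS d' s where
  toFun φ := ⟨permFun σ φ, φ.2.imp fun _ h => permFun_mem σ h⟩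
  map_add' _ _ := rfl
  map_smul' _ _ := rfl
  cont := GS.continuous_of_step fun h =>
    (continuous_stepToGS d' s h).comp (Step.continuous_perm σ s h)

/-- `φ ↦ φ (· ∘ σ)` on `Σ_s`. -/
def Sig.perm (σ : Fin d ≃ Fin d') (s : ℝ) : Sig d s →L[ℂ] Sig d' s where
  toFun φ := ⟨permFun σ φ, (Submodule.mem_iInf _).2 fun h =>
    permFun_mem σ ((Submodule.mem_iInf _).1 φ.2 h)⟩
  map_add' _ _ := rfl
  map_smul' _ _ := rfl
  cont := continuous_iInf_rng.2 fun h => continuous_induced_rng.2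
    ((Step.continuous_perm σ s h).comp (continuous_sigToStep d s h))

theorem permFun_finAddFlip_append (φ : (Fin (d₁ + d₂) → ℝ) → ℂ) (x₁ : Fin d₁ → ℝ)
    (x₂ : Fin d₂ → ℝ) :
    permFun finAddFlip φ (Fin.append x₂ x₁) = φ (Fin.append x₁ x₂) := by
  unfold permFun
  congr 1
  funext i
  refine Fin.addCases (fun i => ?_) (fun i => ?_) i <;> simp

theorem fixFst_permFun (φ : (Fin (d₁ + d₂) → ℝ) → ℂ) (x₂ : Fin d₂ → ℝ) :
    fixFst x₂ (permFun finAddFlip φ) = fixSnd x₂ φ :=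
  funext fun x₁ => permFun_finAddFlip_append φ x₁ x₂

theorem permFun_tensorFun (φ₁ : (Fin d₁ → ℝ) → ℂ) (φ₂ : (Fin d₂ → ℝ) → ℂ) :
    permFun finAddFlip (tensorFun φ₁ φ₂) = tensorFun φ₂ φ₁ := by
  funext x
  simp [permFun, tensorFun, mul_comm]

/-- A function in `𝒮_s(ℝᵈ)` as an element of the topological vector space. -/
def GS.of {s : ℝ} {u : (Fin d → ℝ) → ℂ} (hu : u ∈ gsSub d s) : GS d s := ⟨u, hu⟩

/-- A function in `Σ_s(ℝᵈ)` as an element of the topological vector space. -/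
def Sig.of {s : ℝ} {u : (Fin d → ℝ) → ℂ} (hu : u ∈ sigSub d s) : Sig d s := ⟨u, hu⟩

/-! ### Tensor products in `𝒮_s'` -/

section GS

variable {s : ℝ}

theorem GSDual.pairing_mem_step (f₂ : GSDual d₂ s) (h : {h : ℝ // 0 < h}) :
    ∃ C, 0 ≤ C ∧ ∀ φ : GS (d₁ + d₂) s, ContDiff ℝ ∞ φ.1 → ∀ A, (∀ p, quot s h φ p ≤ A) →
      ContDiff ℝ ∞ (fun x₁ => f₂ (φ.fixFst x₁)) ∧
        ∀ p, quot s h (fun x₁ => f₂ (φ.fixFst x₁)) p ≤ C * A := by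
  obtain ⟨Λ, hΛ⟩ := f₂.exists_ell h
  refine ⟨‖Λ‖, norm_nonneg _, fun φ hφ A hA => pairing_mem le_rfl Λ hφ hA fun x₁ => ?_⟩
  have hx := fixFst_mem x₁ (mem_stepSub_of_le hφ hA)
  exact ⟨hx, (hΛ (.of hx)).symm⟩

/-- The map `φ ↦ (x₁ ↦ ⟨f₂, φ(x₁, ·)⟩)` on `𝒮_s`. -/
noncomputable def GSDual.pairing (f₂ : GSDual d₂ s) : GS (d₁ + d₂) s →ₗ[ℂ] GS d₁ s where
  toFun φ := ⟨fun x₁ => f₂ (φ.fixFst x₁), by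
    obtain ⟨h, hh⟩ := φ.2
    obtain ⟨A, hA⟩ := exists_bound hh
    obtain ⟨C, -, hC⟩ := f₂.pairing_mem_step (d₁ := d₁) h
    exact ⟨h, mem_stepSub_of_le (hC φ hh.1 A hA).1 (hC φ hh.1 A hA).2⟩⟩
  map_add' φ ψ := Subtype.ext (funext fun x₁ => map_add f₂ (φ.fixFst x₁) (ψ.fixFst x₁))
  map_smul' c φ := Subtype.ext (funext fun x₁ => map_smul f₂ c (φ.fixFst x₁))

theorem GSDual.continuous_pairing (f₂ : GSDual d₂ s) :
    Continuous (f₂.pairing : GS (d₁ + d₂) s →ₗ[ℂ] GS d₁ s) := by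
  refine GS.continuous_of_step fun h => ?_
  obtain ⟨C, -, hC⟩ := f₂.pairing_mem_step (d₁ := d₁) h
  have hb : ∀ u : Step (d₁ + d₂) s h, _ := fun u =>
    hC (stepToGS _ s h u) u.2.1 ‖u‖ (Step.quot_le_norm u)
  let T : Step (d₁ + d₂) s h →ₗ[ℂ] Step d₁ s h :=
    { toFun := fun u => .of (mem_stepSub_of_le (hb u).1 (hb u).2)
      map_add' := fun u v => Subtype.ext
        (funext fun x₁ => map_add f₂ ((stepToGS _ s h u).fixFst x₁) ((stepToGS _ s h v).fixFst x₁))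
      map_smul' := fun c u => Subtype.ext
        (funext fun x₁ => map_smul f₂ c ((stepToGS _ s h u).fixFst x₁)) }
  have hT : Continuous T := continuous_of_norm_le T LinearMap.id continuous_id C fun u =>
    Step.norm_le _ (hb u).2
  exact (continuous_stepToGS d₁ s h).comp hT

/-- The functional `φ ↦ ⟨f₁, ⟨f₂, φ(x₁, x₂)⟩⟩` on `𝒮_s`. -/
noncomputable def GSDual.tensor (f₁ : GSDual d₁ s) (f₂ : GSDual d₂ s) : GSDual (d₁ + d₂) s where
  toLinearMap := (f₁ : GS d₁ s →ₗ[ℂ] ℂ) ∘ₗ f₂.pairing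
  cont := f₁.continuous.comp f₂.continuous_pairing

theorem GSDual.isTensor_tensor (f₁ : GSDual d₁ s) (f₂ : GSDual d₂ s) :
    GSDual.IsTensor f₁ f₂ (f₁.tensor f₂) := by
  intro φ₁ φ₂
  have h1 : f₂.pairing (φ₁.tensor φ₂) = f₂ φ₂ • φ₁ := by
    refine Subtype.ext (funext fun x₁ => ?_)
    have h2 : (φ₁.tensor φ₂).fixFst x₁ = φ₁ x₁ • φ₂ := by
      refine Subtype.ext (funext fun x₂ => ?_)
      change tensorFun φ₁ φ₂ (Fin.append x₁ x₂) = φ₁ x₁ * φ₂ x₂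
      simp [tensorFun]
    change f₂ ((φ₁.tensor φ₂).fixFst x₁) = f₂ φ₂ * φ₁ x₁
    rw [h2, map_smul, smul_eq_mul, mul_comm]
  change f₁ (f₂.pairing (φ₁.tensor φ₂)) = _
  rw [h1, map_smul, smul_eq_mul, mul_comm]

theorem GSDual.isTensor_tensor_flip (f₁ : GSDual d₁ s) (f₂ : GSDual d₂ s) :
    GSDual.IsTensor f₁ f₂ ((f₂.tensor f₁).comp (GS.perm finAddFlip s)) := by
  intro φ₁ φ₂
  have h1 : GS.perm finAddFlip s (φ₁.tensor φ₂) = φ₂.tensor φ₁ :=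
    Subtype.ext (permFun_tensorFun φ₁ φ₂)
  rw [ContinuousLinearMap.comp_apply, h1, f₂.isTensor_tensor f₁, mul_comm]

theorem shift_mem_gsSub (hs : 1 / 2 ≤ s) {u : (Fin d → ℝ) → ℂ} (hu : u ∈ gsSub d s)
    (y : Fin d → ℝ) : shift y u ∈ gsSub d s := by
  obtain ⟨h, hh⟩ := hu
  obtain ⟨h', hh'⟩ := gauss_mem_gsSub (d := d) hs one_pos
  have hs0 : 0 ≤ s := by linarith
  exact ⟨⟨2 * (2 ^ s * (max h h' : {h : ℝ // 0 < h})), by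
      have := (max h h').2
      positivity⟩,
    shift_mem hs0 (stepSub_mono d s (le_max_right h h') hh') (gauss_ne_zero 1)
      (stepSub_mono d s (le_max_left h h') hh) le_rfl y⟩

/-- Tensor products span a dense subspace of `𝒮_s`, in the form needed here. -/
theorem GSDual.eq_zero_of_tensor (hs : 1 / 2 ≤ s) (f : GSDual (d₁ + d₂) s)
    (hf : ∀ (φ₁ : GS d₁ s) (φ₂ : GS d₂ s), f (φ₁.tensor φ₂) = 0) : f = 0 := by
  ext φ
  have hs0 : 0 ≤ s := by linarith
  have key := eq_zero_of_gauss hs0 (φ := φ.1)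
    (F := fun y => f (.of (shift_mem_gsSub hs φ.2 y))) ?_
  · have h0 : shift 0 φ.1 = φ.1 := shift_zero φ.1
    exact (congrArg f (Subtype.ext h0.symm)).trans key
  intro b hb
  obtain ⟨h₁, hφ⟩ := φ.2
  obtain ⟨h₂, h1⟩ := gauss_mem_gsSub (d := d₁ + d₂) hs one_pos
  obtain ⟨h₃, hg⟩ := gauss_mem_gsSub (d := d₁ + d₂) hs hb
  set h := max h₁ (max h₂ h₃) with hh
  have hpos : 0 < 2 * (2 ^ s * (2 ^ s * (h : ℝ))) := by
    have := h.2
    positivity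
  obtain ⟨Λ, hΛ⟩ := f.exists_ell ⟨_, hpos⟩
  refine ⟨h, ⟨_, hpos⟩, Λ, le_rfl, stepSub_mono _ s (le_max_left _ _) hφ,
    stepSub_mono _ s ((le_max_left _ _).trans (le_max_right _ _)) h1,
    stepSub_mono _ s ((le_max_right _ _).trans (le_max_right _ _)) hg,
    fun y hy => (hΛ (.of hy)).symm, fun y hy => ?_⟩
  rw [hΛ]
  have h2 : stepToGS _ s ⟨_, hpos⟩ (.of hy) =
      GS.tensor (.of (shift_mem_gsSub hs (gauss_mem_gsSub hs hb) (fun i => y (Fin.castAdd d₂ i))))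
        (.of (shift_mem_gsSub hs (gauss_mem_gsSub hs hb) (fun j => y (Fin.natAdd d₁ j)))) :=
    Subtype.ext (shift_gauss_add b y)
  rw [h2, hf]

theorem GSDual.IsTensor.unique (hs : 1 / 2 ≤ s) {f₁ : GSDual d₁ s} {f₂ : GSDual d₂ s}
    {f g : GSDual (d₁ + d₂) s} (hf : GSDual.IsTensor f₁ f₂ f) (hg : GSDual.IsTensor f₁ f₂ g) :
    f = g :=
  sub_eq_zero.1 <| GSDual.eq_zero_of_tensor hs (f - g) fun φ₁ φ₂ => by
    rw [sub_apply, hf, hg, sub_self]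

end GS

/-! ### Tensor products in `Σ_s'` -/

section Sig

variable {s : ℝ}

theorem SigDual.pairing_mem_step (f₂ : SigDual d₂ s) (h : {h : ℝ // 0 < h}) :
    ∃ (m : {h : ℝ // 0 < h}) (C : ℝ), m ≤ h ∧ ∀ φ : Sig (d₁ + d₂) s,
      ContDiff ℝ ∞ (fun x₁ => f₂ (φ.fixFst x₁)) ∧
        ∀ p, quot s h (fun x₁ => f₂ (φ.fixFst x₁)) p ≤ C * ‖sigToStep _ s m φ‖ := by
  obtain ⟨k, Λ, hΛ⟩ := f₂.exists_ell
  refine ⟨min h k, ‖Λ‖, min_le_left _ _, fun φ => ?_⟩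
  have h1 := pairing_mem (min_le_right h k) Λ (sigToStep _ s (min h k) φ).2.1
    (Step.quot_le_norm (sigToStep _ s (min h k) φ)) (g := fun x₁ => f₂ (φ.fixFst x₁))
    fun x₁ => ⟨(Submodule.mem_iInf _).1 (φ.fixFst x₁).2 k, (hΛ (φ.fixFst x₁)).symm⟩
  exact ⟨h1.1, fun p => (quot_anti s (min h k).2 (min_le_left h k) _ p).trans (h1.2 p)⟩

/-- The map `φ ↦ (x₁ ↦ ⟨f₂, φ(x₁, ·)⟩)` on `Σ_s`. -/
noncomputable def SigDual.pairing (f₂ : SigDual d₂ s) : Sig (d₁ + d₂) s →ₗ[ℂ] Sig d₁ s where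
  toFun φ := ⟨fun x₁ => f₂ (φ.fixFst x₁), (Submodule.mem_iInf _).2 fun h => by
    obtain ⟨m, C, -, hC⟩ := f₂.pairing_mem_step (d₁ := d₁) h
    exact mem_stepSub_of_le (hC φ).1 (hC φ).2⟩
  map_add' φ ψ := Subtype.ext (funext fun x₁ => map_add f₂ (φ.fixFst x₁) (ψ.fixFst x₁))
  map_smul' c φ := Subtype.ext (funext fun x₁ => map_smul f₂ c (φ.fixFst x₁))

theorem SigDual.continuous_pairing (f₂ : SigDual d₂ s) :
    Continuous (f₂.pairing : Sig (d₁ + d₂) s →ₗ[ℂ] Sig d₁ s) := by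
  refine continuous_iInf_rng.2 fun h => continuous_induced_rng.2 ?_
  obtain ⟨m, C, -, hC⟩ := f₂.pairing_mem_step (d₁ := d₁) h
  exact continuous_of_norm_le (sigToStep d₁ s h ∘ₗ f₂.pairing) (sigToStep _ s m)
    (continuous_sigToStep _ s m) C fun φ => Step.norm_le _ (hC φ).2

/-- The functional `φ ↦ ⟨f₁, ⟨f₂, φ(x₁, x₂)⟩⟩` on `Σ_s`. -/
noncomputable def SigDual.tensor (f₁ : SigDual d₁ s) (f₂ : SigDual d₂ s) : SigDual (d₁ + d₂) s where
  toLinearMap := (f₁ : Sig d₁ s →ₗ[ℂ] ℂ) ∘ₗ f₂.pairing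
  cont := f₁.continuous.comp f₂.continuous_pairing

theorem SigDual.isTensor_tensor (f₁ : SigDual d₁ s) (f₂ : SigDual d₂ s) :
    SigDual.IsTensor f₁ f₂ (f₁.tensor f₂) := by
  intro φ₁ φ₂
  have h1 : f₂.pairing (φ₁.tensor φ₂) = f₂ φ₂ • φ₁ := by
    refine Subtype.ext (funext fun x₁ => ?_)
    have h2 : (φ₁.tensor φ₂).fixFst x₁ = φ₁ x₁ • φ₂ := by
      refine Subtype.ext (funext fun x₂ => ?_)
      change tensorFun φ₁ φ₂ (Fin.append x₁ x₂) = φ₁ x₁ * φ₂ x₂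
      simp [tensorFun]
    change f₂ ((φ₁.tensor φ₂).fixFst x₁) = f₂ φ₂ * φ₁ x₁
    rw [h2, map_smul, smul_eq_mul, mul_comm]
  change f₁ (f₂.pairing (φ₁.tensor φ₂)) = _
  rw [h1, map_smul, smul_eq_mul, mul_comm]

theorem SigDual.isTensor_tensor_flip (f₁ : SigDual d₁ s) (f₂ : SigDual d₂ s) :
    SigDual.IsTensor f₁ f₂ ((f₂.tensor f₁).comp (Sig.perm finAddFlip s)) := by
  intro φ₁ φ₂
  have h1 : Sig.perm finAddFlip s (φ₁.tensor φ₂) = φ₂.tensor φ₁ :=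
    Subtype.ext (permFun_tensorFun φ₁ φ₂)
  rw [ContinuousLinearMap.comp_apply, h1, f₂.isTensor_tensor f₁, mul_comm]

theorem shift_mem_sigSub (hs : 1 / 2 < s) {u : (Fin d → ℝ) → ℂ} (hu : u ∈ sigSub d s)
    (y : Fin d → ℝ) : shift y u ∈ sigSub d s := by
  have hs0 : 0 ≤ s := by linarith
  refine (Submodule.mem_iInf _).2 fun k => ?_
  have hk := k.2
  let h : {h : ℝ // 0 < h} := ⟨k / (2 * 2 ^ s), by positivity⟩
  refine shift_mem (h := h) hs0 ((Submodule.mem_iInf _).1 (gauss_mem_sigSub hs one_pos) h)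
    (gauss_ne_zero 1) ((Submodule.mem_iInf _).1 hu h) (le_of_eq ?_) y
  simp only [h]
  field_simp

/-- Tensor products span a dense subspace of `Σ_s`, in the form needed here. -/
theorem SigDual.eq_zero_of_tensor (hs : 1 / 2 < s) (f : SigDual (d₁ + d₂) s)
    (hf : ∀ (φ₁ : Sig d₁ s) (φ₂ : Sig d₂ s), f (φ₁.tensor φ₂) = 0) : f = 0 := by
  ext φ
  have hs0 : 0 ≤ s := by linarith
  have key := eq_zero_of_gauss hs0 (φ := φ.1)
    (F := fun y => f (.of (shift_mem_sigSub hs φ.2 y))) ?_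
  · have h0 : shift 0 φ.1 = φ.1 := shift_zero φ.1
    exact (congrArg f (Subtype.ext h0.symm)).trans key
  intro b hb
  obtain ⟨k, Λ, hΛ⟩ := f.exists_ell
  have hk := k.2
  let h : {h : ℝ // 0 < h} := ⟨k / (2 * (2 ^ s * 2 ^ s)), by positivity⟩
  refine ⟨h, k, Λ, le_of_eq (by simp only [h]; field_simp), (Submodule.mem_iInf _).1 φ.2 h,
    (Submodule.mem_iInf _).1 (gauss_mem_sigSub hs one_pos) h,
    (Submodule.mem_iInf _).1 (gauss_mem_sigSub hs hb) h,
    fun y hy => (hΛ (.of (shift_mem_sigSub hs φ.2 y))).symm, fun y hy => ?_⟩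
  have h2 : Sig.of (shift_mem_sigSub hs (gauss_mem_sigSub hs hb) y) =
      Sig.tensor (.of (shift_mem_sigSub hs (gauss_mem_sigSub hs hb) (fun i => y (Fin.castAdd d₂ i))))
        (.of (shift_mem_sigSub hs (gauss_mem_sigSub hs hb) (fun j => y (Fin.natAdd d₁ j)))) :=
    Subtype.ext (shift_gauss_add b y)
  exact (hΛ (.of (shift_mem_sigSub hs (gauss_mem_sigSub hs hb) y))).trans
    ((congrArg f h2).trans (hf _ _))

theorem SigDual.IsTensor.unique (hs : 1 / 2 < s) {f₁ : SigDual d₁ s} {f₂ : SigDual d₂ s}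
    {f g : SigDual (d₁ + d₂) s} (hf : SigDual.IsTensor f₁ f₂ f) (hg : SigDual.IsTensor f₁ f₂ g) :
    f = g :=
  sub_eq_zero.1 <| SigDual.eq_zero_of_tensor hs (f - g) fun φ₁ φ₂ => by
    rw [sub_apply, hf, hg, sub_self]

end Sig

end GelfandShilov

theorem theoremA2 :
    (∀ (d₁ d₂ : ℕ) (s : ℝ), 1 / 2 ≤ s →
      ∀ (f₁ : GelfandShilov.GSDual d₁ s) (f₂ : GelfandShilov.GSDual d₂ s),
        (∃! f : GelfandShilov.GSDual (d₁ + d₂) s, GelfandShilov.GSDual.IsTensor f₁ f₂ f) ∧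
        ∀ f : GelfandShilov.GSDual (d₁ + d₂) s, GelfandShilov.GSDual.IsTensor f₁ f₂ f →
          ∀ φ : GelfandShilov.GS (d₁ + d₂) s,
            (∃ g₁ : GelfandShilov.GS d₁ s, (∀ x₁, g₁ x₁ = f₂ (φ.fixFst x₁)) ∧ f φ = f₁ g₁) ∧
            (∃ g₂ : GelfandShilov.GS d₂ s, (∀ x₂, g₂ x₂ = f₁ (φ.fixSnd x₂)) ∧ f φ = f₂ g₂)) ∧
    (∀ (d₁ d₂ : ℕ) (s : ℝ), 1 / 2 < s →
      ∀ (f₁ : GelfandShilov.SigDual d₁ s) (f₂ : GelfandShilov.SigDual d₂ s),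
        (∃! f : GelfandShilov.SigDual (d₁ + d₂) s, GelfandShilov.SigDual.IsTensor f₁ f₂ f) ∧
        ∀ f : GelfandShilov.SigDual (d₁ + d₂) s, GelfandShilov.SigDual.IsTensor f₁ f₂ f →
          ∀ φ : GelfandShilov.Sig (d₁ + d₂) s,
            (∃ g₁ : GelfandShilov.Sig d₁ s, (∀ x₁, g₁ x₁ = f₂ (φ.fixFst x₁)) ∧ f φ = f₁ g₁) ∧
            (∃ g₂ : GelfandShilov.Sig d₂ s, (∀ x₂, g₂ x₂ = f₁ (φ.fixSnd x₂)) ∧ f φ = f₂ g₂)) := by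
  refine ⟨fun d₁ d₂ s hs f₁ f₂ => ⟨⟨f₁.tensor f₂, f₁.isTensor_tensor f₂, fun f hf =>
      hf.unique hs (f₁.isTensor_tensor f₂)⟩, fun f hf φ => ⟨⟨f₂.pairing φ, fun _ => rfl, ?_⟩,
      ⟨f₁.pairing (GelfandShilov.GS.perm finAddFlip s φ), fun x₂ => ?_, ?_⟩⟩⟩,
    fun d₁ d₂ s hs f₁ f₂ => ⟨⟨f₁.tensor f₂, f₁.isTensor_tensor f₂, fun f hf =>
      hf.unique hs (f₁.isTensor_tensor f₂)⟩, fun f hf φ => ⟨⟨f₂.pairing φ, fun _ => rfl, ?_⟩,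
      ⟨f₁.pairing (GelfandShilov.Sig.perm finAddFlip s φ), fun x₂ => ?_, ?_⟩⟩⟩⟩
  · rw [hf.unique hs (f₁.isTensor_tensor f₂)]
    rfl
  · exact congrArg f₁ (Subtype.ext (GelfandShilov.fixFst_permFun φ.1 x₂))
  · rw [hf.unique hs (f₁.isTensor_tensor_flip f₂)]
    rfl
  · rw [hf.unique hs (f₁.isTensor_tensor f₂)]
    rfl
  · exact congrArg f₁ (Subtype.ext (GelfandShilov.fixFst_permFun φ.1 x₂))
  · rw [hf.unique hs (f₁.isTensor_tensor_flip f₂)]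
    rfl
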